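/- Let $\mathcal H$ be a finite-dimensional complex Hilbert space, $\mathcal L_h$ the space of Hermitian operators on $\mathcal H$, and $\mathcal S=\mathcal S(\mathcal H)$ the manifold of strictly positive density operators, whose tangent space at every point is identified with the space of traceless Hermitian operators. Put $\langle A\rangle_\rho=\operatorname{Tr}(\rho A)$ and $\langle A,B\rangle_\rho=\operatorname{Re}\operatorname{Tr}(\rho AB)$ for $A,B\in\mathcal L_h$. For a tangent vector $v$ at $\rho$, the symmetric logarithmic derivative $L_v\in\mathcal L_h$ is defined by $\operatorname{Tr}(vA)=\langle L_v,A\rangle_\rho$ for all $A\in\mathcal L_h$, and the SLD metric on $\mathcal S$ is $g_\rho(v,w)=\langle L_v,L_w\rangle_\rho$. The m-connection $\nabla^{(m)}$ is the flat connection that $\mathcal S$ inherits as an open subset of the affine space of Hermitian operators of trace $1$, and the e-connection $\nabla^{(e)}$ is its dual with respect to $g$: $Xg(Y,Z)=g(\nabla^{(e)}_XY,Z)+g(Y,\nabla^{(m)}_XZ)$ for all vector fields $X,Y,Z$ on $\mathcal S$. An $n$-dimensional model $(\mathcal M,\xi)$ consists of a connected $n$-dimensional (immersed) submanifold $\mathcal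 M$ of $\mathcal S$ and a global coordinate system $\xi=(\xi^1,\dots,\xi^n):\mathcal M\to\mathbb R^n$; write $\partial_i=\partial/\partial\xi^i$. $\mathcal M$ is called e-autoparallel in $\mathcal S$ if $\nabla^{(e)}_XY$ is tangent to $\mathcal M$ for all vector fields $X,Y$ on $\mathcal M$. In this case let $\nabla^{(m)}_{\mathcal M}$ be the connection on $\mathcal M$ that is dual, with respect to $g|_{\mathcal M}$, to the connection induced by $\nabla^{(e)}$ on $\mathcal M$; $\xi$ is called m-affine if $(\nabla^{(m)}_{\mathcal M})_{\partial_i}\partial_j=0$ for all $i,j$. For a smooth function $f:\mathcal M\to\mathbb R$, an estimator is a POVM $\Lambda$ on the Borel sets of $\mathbb R$, with $E_\rho(\Lambda)=\int t\,\operatorname{Tr}(\rho\,\Lambda(dt))$ and $V_\rho(\Lambda)=\int(t-f(\rho))^2\operatorname{Tr}(\rho\,\Lambda(dt))$. It is efficient for $f$ if, at every $\rho\in\mathcal M$, it is locally unbiased, i.e. $E_\rho(\Lambda)=f(\rho)$ and $(dE(\Lambda))_\rho=(df)_\rho$ on $\mathcal M$ (the expectations being finite), and $V_\rho(\Lambda)=\|(df)_\rho\|_\rho^2:=\sum_{i,j}g^{ij}(\rho)\,\partial_if(\rho)\,\partial_jf(\rho)$,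 where $[g^{ij}]=[g(\partial_i,\partial_j)]^{-1}$. Let $\mathcal E(\mathcal M)$ be the set of smooth functions on $\mathcal M$ that admit an efficient estimator. Theorem. For an $n$-dimensional model $(\mathcal M,\xi)$ the following conditions are equivalent. (i) $\mathcal M$ is e-autoparallel in $\mathcal S$, and $\xi$ is an m-affine coordinate system. (ii) $\xi^i\in\mathcal E(\mathcal M)$ for every $i\in\{1,\dots,n\}$. (iii) $\mathcal E(\mathcal M)=\bigl\{c+\sum_{i=1}^n u_i\xi^i \,\big|\, (c,u_1,\dots,u_n)\in\mathbb R^{n+1}\bigr\}$. -/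

import Mathlib

open Set Filter Topology MeasureTheory
open scoped ContDiff

set_option linter.unusedSectionVars false
set_option linter.style.haveILetI false

noncomputable section

namespace QuantumModel

/-! ### Operators, states and the SLD inner product -/

section Operators

variable (H : Type*) [NormedAddCommGroup H] [InnerProductSpace ℂ H]

/-- Linear operators on the (finite-dimensional) Hilbert space `H`. -/
abbrev Op := H →L[ℂ] H

/-- Hermitian operators. -/
def hermitian : Set (Op H) := {A | ∀ x y : H, inner ℂ (A x) y = inner ℂ x (A y)}

variable {H}

/-- The trace of an operator. -/
def tr (A : Op H) : ℂ := LinearMap.trace ℂ H (A : H →ₗ[ℂ] H)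

variable (H)

/-- The strictly positive density operators on `H`. -/
def states : Set (Op H) :=
  {ρ | ρ ∈ hermitian H ∧ (∀ x : H, x ≠ 0 → 0 < (inner ℂ x (ρ x)).re) ∧ tr ρ = 1}

/-- Traceless Hermitian operators: the tangent space of `states H` at each of its points,
a tangent vector being identified with its image under the differential of the inclusion of
`states H` into the affine space of Hermitian operators of trace one. -/
def tangent : Set (Op H) := {A | A ∈ hermitian H ∧ tr A = 0}

variable {H}

/-- The symmetrized inner product `⟨A, B⟩_ρ = Re Tr (ρ A B)`. -/
def symInner (ρ A B : Op H) : ℝ := (tr (ρ * A * B)).re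

/-- `L` is the symmetric logarithmic derivative (SLD) of the tangent vector `v` at `ρ`: the
derivative `Tr (v A)` of the expectation of each observable `A` along `v` is `⟨L, A⟩_ρ`. -/
def IsSLD (ρ v L : Op H) : Prop :=
  L ∈ hermitian H ∧ ∀ A ∈ hermitian H, (tr (v * A)).re = symInner ρ L A

open Classical in
/-- The SLD of the tangent vector `v` at `ρ` (it exists and is unique, see `isSLD_sld` and
`IsSLD.unique`). -/
def sld (ρ v : Op H) : Op H := if h : ∃ L, IsSLD ρ v L then h.choose else 0

/-- The SLD metric `g_ρ (v, w) = ⟨L_v, L_w⟩_ρ`. -/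
def metric (ρ v w : Op H) : ℝ := symInner ρ (sld ρ v) (sld ρ w)

end Operators

section Proofs

variable {H : Type*} [NormedAddCommGroup H] [InnerProductSpace ℂ H] [FiniteDimensional ℂ H]

theorem tr_mul_comm (A B : Op H) : tr (A * B) = tr (B * A) :=
  LinearMap.trace_mul_comm ℂ (A : H →ₗ[ℂ] H) (B : H →ₗ[ℂ] H)

theorem tr_eq_sum (A : Op H) :
    tr A = ∑ i, inner ℂ (stdOrthonormalBasis ℂ H i) (A (stdOrthonormalBasis ℂ H i)) :=
  LinearMap.trace_eq_sum_inner _ _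

/-- The trace of a product of positive operators is nonnegative. -/
theorem tr_mul_nonneg {ρ E : Op H} (hρ : ρ.IsPositive) (hE : E.IsPositive) :
    0 ≤ (tr (ρ * E)).re := by
  have hs := hρ.isSymmetric
  rw [tr_mul_comm, tr, LinearMap.trace_eq_sum_inner _ (hs.eigenvectorBasis rfl), Complex.re_sum]
  refine Finset.sum_nonneg fun i _ => ?_
  have h1 : (ρ : H →ₗ[ℂ] H) (hs.eigenvectorBasis rfl i) =
      ((hs.eigenvalues rfl i : ℝ) : ℂ) • hs.eigenvectorBasis rfl i :=
    hs.apply_eigenvectorBasis rfl i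
  have h2 : 0 ≤ hs.eigenvalues rfl i := by
    have := hρ.re_inner_nonneg_right (hs.eigenvectorBasis rfl i)
    have h3 : ρ (hs.eigenvectorBasis rfl i) =
      ((hs.eigenvalues rfl i : ℝ) : ℂ) • hs.eigenvectorBasis rfl i := h1
    rw [h3, inner_smul_right] at this
    simpa using this
  have h4 : ((E * ρ : Op H) : H →ₗ[ℂ] H) (hs.eigenvectorBasis rfl i) =
      ((hs.eigenvalues rfl i : ℝ) : ℂ) • E (hs.eigenvectorBasis rfl i) := by
    change E (ρ (hs.eigenvectorBasis rfl i)) = _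
    have h3 : ρ (hs.eigenvectorBasis rfl i) =
      ((hs.eigenvalues rfl i : ℝ) : ℂ) • hs.eigenvectorBasis rfl i := h1
    rw [h3, map_smul]
  rw [h4, inner_smul_right, Complex.re_ofReal_mul]
  exact mul_nonneg h2 (hE.re_inner_nonneg_right _)

theorem isPositive_of_mem_states {ρ : Op H} (hρ : ρ ∈ states H) : ρ.IsPositive := by
  refine ⟨hρ.1, fun x => ?_⟩
  by_cases hx : x = 0
  · simp [hx, ContinuousLinearMap.reApplyInnerSelf]
  · rw [ContinuousLinearMap.reApplyInnerSelf, hρ.1]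
    exact (hρ.2.1 x hx).le

theorem mem_hermitian_iff [CompleteSpace H] {A : Op H} : A ∈ hermitian H ↔ star A = A := by
  rw [← isSelfAdjoint_iff, ContinuousLinearMap.isSelfAdjoint_iff_isSymmetric]
  rfl

theorem tr_star [CompleteSpace H] (A : Op H) : tr (star A) = star (tr A) := by
  rw [tr_eq_sum, tr_eq_sum, star_sum]
  refine Finset.sum_congr rfl fun i _ => ?_
  rw [ContinuousLinearMap.star_eq_adjoint, ContinuousLinearMap.adjoint_inner_right]
  exact (inner_conj_symm _ _).symm

theorem eq_zero_of_tr [CompleteSpace H] {ρ A : Op H} (hρ : ρ ∈ states H)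
    (h : (tr (ρ * (A * star A))).re ≤ 0) : A = 0 := by
  have h1 : tr (ρ * (A * star A)) = ∑ i, inner ℂ (A (stdOrthonormalBasis ℂ H i))
      (ρ (A (stdOrthonormalBasis ℂ H i))) := by
    rw [← mul_assoc, tr_mul_comm, tr_eq_sum]
    refine Finset.sum_congr rfl fun i _ => ?_
    change inner ℂ _ (star A (ρ (A _))) = _
    rw [ContinuousLinearMap.star_eq_adjoint, ContinuousLinearMap.adjoint_inner_right]
  rw [h1, Complex.re_sum] at h
  have h2 : ∀ x : H, 0 ≤ (inner ℂ x (ρ x)).re := fun x =>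
    (isPositive_of_mem_states hρ).re_inner_nonneg_right x
  have h3 := (Finset.sum_eq_zero_iff_of_nonneg (fun i _ => h2 _)).1
    (le_antisymm h (Finset.sum_nonneg fun i _ => h2 _))
  have h4 : ∀ i, A (stdOrthonormalBasis ℂ H i) = 0 := fun i => by
    by_contra hne
    exact (hρ.2.1 _ hne).ne' (h3 i (Finset.mem_univ i))
  have h5 : (A : H →ₗ[ℂ] H) = 0 :=
    (stdOrthonormalBasis ℂ H).toBasis.ext fun i => by simpa using h4 i
  exact ContinuousLinearMap.coe_injective (by simpa using h5)

theorem IsSLD.unique {ρ v L L' : Op H} (hρ : ρ ∈ states H) (h : IsSLD ρ v L)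
    (h' : IsSLD ρ v L') : L = L' := by
  haveI := FiniteDimensional.complete ℂ H
  have hd : star (L - L') = L - L' := by
    rw [star_sub, mem_hermitian_iff.1 h.1, mem_hermitian_iff.1 h'.1]
  have h1 := (h.2 _ (mem_hermitian_iff.2 hd)).symm.trans (h'.2 _ (mem_hermitian_iff.2 hd))
  refine sub_eq_zero.1 (eq_zero_of_tr hρ ?_)
  have h2 : ρ * ((L - L') * star (L - L')) = ρ * L * (L - L') - ρ * L' * (L - L') := by
    rw [hd]; noncomm_ring
  rw [h2, tr, ContinuousLinearMap.toLinearMap_sub, map_sub, Complex.sub_re]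
  unfold symInner tr at h1
  linarith

/-- The super-operator `A ↦ ρ ∘ A = (ρ A + A ρ) / 2`. -/
def omega (H : Type*) [NormedAddCommGroup H] [InnerProductSpace ℂ H] :
    Op H →L[ℝ] Op H →L[ℝ] Op H :=
  (1 / 2 : ℝ) • (ContinuousLinearMap.mul ℝ (Op H) + (ContinuousLinearMap.mul ℝ (Op H)).flip)

theorem omega_apply (ρ A : Op H) : omega H ρ A = (1 / 2 : ℝ) • (ρ * A + A * ρ) := by
  simp [omega]

theorem tr_add (A B : Op H) : tr (A + B) = tr A + tr B := by
  simp [tr]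

theorem tr_smul (c : ℝ) (A : Op H) : tr (c • A) = c * tr A := by
  have : c • A = (c : ℂ) • A := rfl
  rw [this, tr, ContinuousLinearMap.toLinearMap_smul, map_smul]
  rfl

/-- `A ↦ Re Tr A` as a continuous real-linear functional. -/
def reTr (H : Type*) [NormedAddCommGroup H] [InnerProductSpace ℂ H] [FiniteDimensional ℂ H] :
    Op H →L[ℝ] ℝ :=
  haveI : FiniteDimensional ℝ (Op H) := FiniteDimensional.complexToReal (Op H)
  LinearMap.toContinuousLinearMap
    { toFun := fun A => (tr A).re
      map_add' := fun A B => by rw [tr_add, Complex.add_re]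
      map_smul' := fun c A => by rw [tr_smul, Complex.re_ofReal_mul]; rfl }

@[simp] theorem reTr_apply (A : Op H) : reTr H A = (tr A).re := rfl

theorem re_tr_omega [CompleteSpace H] {ρ A B : Op H} (hρ : ρ ∈ hermitian H)
    (hA : A ∈ hermitian H) (hB : B ∈ hermitian H) :
    (tr (omega H ρ A * B)).re = symInner ρ A B := by
  rw [mem_hermitian_iff] at hρ hA hB
  have h1 : (tr (A * ρ * B)).re = (tr (ρ * A * B)).re := by
    have h2 : star (A * ρ * B) = B * (ρ * A) := by
      rw [star_mul, star_mul, hρ, hA, hB]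
    have h3 := tr_star (A * ρ * B)
    rw [h2, tr_mul_comm] at h3
    rw [h3]
    simp
  rw [omega_apply, smul_mul_assoc, tr_smul, Complex.re_ofReal_mul, add_mul, tr_add,
    Complex.add_re, h1, symInner]
  ring

theorem omega_injective [CompleteSpace H] {ρ : Op H} (hρ : ρ ∈ states H) :
    Function.Injective (omega H ρ) := by
  rw [injective_iff_map_eq_zero]
  intro A hA
  rw [omega_apply, smul_eq_zero] at hA
  have hA' : ρ * A + A * ρ = 0 := hA.resolve_left (by norm_num)
  refine eq_zero_of_tr hρ ?_
  have h1 : (tr ((ρ * A + A * ρ) * star A)).re = 0 := by rw [hA']; simp [tr]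
  have h2 : tr ((ρ * A + A * ρ) * star A) =
      tr (ρ * (A * star A)) + tr (ρ * (star A * A)) := by
    rw [add_mul, tr_add, mul_assoc, mul_assoc, tr_mul_comm A, mul_assoc]
  have h3 : 0 ≤ (tr (ρ * (star A * A))).re := by
    refine tr_mul_nonneg (isPositive_of_mem_states hρ) ?_
    rw [ContinuousLinearMap.star_eq_adjoint]
    exact ContinuousLinearMap.isPositive_adjoint_comp_self A
  rw [h2, Complex.add_re] at h1
  linarith

theorem isUnit_omega [CompleteSpace H] {ρ : Op H} (hρ : ρ ∈ states H) :
    IsUnit (omega H ρ) := by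
  haveI : FiniteDimensional ℝ (Op H) := FiniteDimensional.complexToReal (Op H)
  let e := (LinearEquiv.ofInjectiveEndo (omega H ρ : Op H →ₗ[ℝ] Op H)
    (omega_injective hρ)).toContinuousLinearEquiv
  have he : (e : Op H →L[ℝ] Op H) = omega H ρ := by ext1 A; rfl
  rw [← he]
  exact ⟨⟨e, e.symm, by ext1 A; exact e.apply_symm_apply A, by ext1 A; exact e.symm_apply_apply A⟩, rfl⟩

theorem isSLD_of_omega [CompleteSpace H] {ρ v L : Op H} (hρ : ρ ∈ states H)
    (hv : v ∈ hermitian H) (h : omega H ρ L = v) : IsSLD ρ v L := by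
  have hρ' := mem_hermitian_iff.1 hρ.1
  have hL : L ∈ hermitian H := by
    rw [mem_hermitian_iff] at hv ⊢
    refine omega_injective hρ ?_
    have h1 : omega H ρ (star L) = star (omega H ρ L) := by
      have h2 : ∀ A : Op H, star ((1 / 2 : ℝ) • A) = (1 / 2 : ℝ) • star A := fun A => by
        have h3 : ∀ B : Op H, (1 / 2 : ℝ) • B = ((1 / 2 : ℝ) : ℂ) • B := fun _ => rfl
        rw [h3, h3, star_smul]
        simp
      rw [omega_apply, omega_apply, h2, star_add, star_mul, star_mul, hρ', add_comm]
    rw [h1, h, hv]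
  refine ⟨hL, fun A hA => ?_⟩
  rw [← h, re_tr_omega hρ.1 hL hA]

/-- The SLD exists. -/
theorem isSLD_sld {ρ v : Op H} (hρ : ρ ∈ states H) (hv : v ∈ hermitian H) :
    IsSLD ρ v (sld ρ v) := by
  haveI := FiniteDimensional.complete ℂ H
  haveI : FiniteDimensional ℝ (Op H) := FiniteDimensional.complexToReal (Op H)
  have h : ∃ L, IsSLD ρ v L := by
    obtain ⟨L, hL⟩ := LinearMap.surjective_of_injective
      (f := (omega H ρ : Op H →ₗ[ℝ] Op H)) (omega_injective hρ) v
    exact ⟨L, isSLD_of_omega hρ hv hL⟩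
  rw [sld, dif_pos h]
  exact h.choose_spec

theorem sld_eq_inverse [CompleteSpace H] {ρ v : Op H} (hρ : ρ ∈ states H)
    (hv : v ∈ hermitian H) : sld ρ v = Ring.inverse (omega H ρ) v := by
  refine (isSLD_sld hρ hv).unique hρ (isSLD_of_omega hρ hv ?_)
  exact congrArg (fun T : Op H →L[ℝ] Op H => T v) (Ring.mul_inverse_cancel _ (isUnit_omega hρ))

theorem omega_sld [CompleteSpace H] {ρ v : Op H} (hρ : ρ ∈ states H)
    (hv : v ∈ hermitian H) : omega H ρ (sld ρ v) = v := by
  rw [sld_eq_inverse hρ hv]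
  exact congrArg (fun T : Op H →L[ℝ] Op H => T v) (Ring.mul_inverse_cancel _ (isUnit_omega hρ))

theorem metric_eq {ρ v w : Op H} (hρ : ρ ∈ states H) (hv : v ∈ hermitian H)
    (hw : w ∈ hermitian H) : metric ρ v w = reTr H (v * sld ρ w) :=
  ((isSLD_sld hρ hv).2 _ (isSLD_sld hρ hw).1).symm

theorem symInner_comm {ρ A B : Op H} (hρ : ρ ∈ hermitian H) (hA : A ∈ hermitian H)
    (hB : B ∈ hermitian H) : symInner ρ A B = symInner ρ B A := by
  haveI := FiniteDimensional.complete ℂ H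
  have h3 := tr_star (ρ * A * B)
  rw [mem_hermitian_iff] at hρ hA hB
  rw [star_mul, star_mul, hρ, hA, hB, ← mul_assoc, tr_mul_comm, ← mul_assoc] at h3
  rw [symInner, symInner, h3]
  simp

theorem metric_comm {ρ v w : Op H} (hρ : ρ ∈ states H) (hv : v ∈ hermitian H)
    (hw : w ∈ hermitian H) : metric ρ v w = metric ρ w v :=
  symInner_comm hρ.1 (isSLD_sld hρ hv).1 (isSLD_sld hρ hw).1

/-- The SLD metric is definite. -/
theorem eq_zero_of_metric {ρ v : Op H} (hρ : ρ ∈ states H) (hv : v ∈ hermitian H)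
    (h : metric ρ v v = 0) : v = 0 := by
  haveI := FiniteDimensional.complete ℂ H
  have h1 := (isSLD_sld hρ hv).1
  have h2 : sld ρ v = 0 := by
    refine eq_zero_of_tr hρ (le_of_eq ?_)
    rw [mem_hermitian_iff.1 h1, ← mul_assoc]
    exact h
  rw [← omega_sld hρ hv, h2, map_zero]

theorem isClosed_hermitian : IsClosed (hermitian H) := by
  simp only [hermitian, ofPred_forall]
  refine isClosed_iInter fun x => isClosed_iInter fun y => isClosed_eq ?_ ?_ <;> fun_prop

/-- `states H` is open along Hermitian traceless directions. -/
theorem eventually_mem_states {ρ v : Op H} (hρ : ρ ∈ states H) (hv : v ∈ tangent H) :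
    ∀ᶠ t in 𝓝 (0 : ℝ), ρ + t • v ∈ states H := by
  haveI := FiniteDimensional.proper ℂ H
  obtain ⟨c, hc, hcx⟩ := (isCompact_sphere (0 : H) 1).exists_forall_le'
    (f := fun x => (inner ℂ x (ρ x)).re) (a := 0) (by fun_prop)
    (fun x hx => hρ.2.1 x (ne_zero_of_mem_unit_sphere ⟨x, hx⟩))
  have h1 : ∀ᶠ t in 𝓝 (0 : ℝ), |t| * ‖v‖ < c := by
    have : Tendsto (fun t : ℝ => |t| * ‖v‖) (𝓝 0) (𝓝 (|0| * ‖v‖)) :=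
      Continuous.tendsto (by fun_prop) 0
    exact this.eventually (gt_mem_nhds (by simpa using hc))
  filter_upwards [h1] with t ht
  have hsm : ∀ x, (t • v : Op H) x = (t : ℂ) • v x := fun x => rfl
  refine ⟨fun x y => ?_, fun x hx => ?_, ?_⟩
  · simp only [add_apply, hsm, inner_add_left, inner_add_right,
      inner_smul_left, inner_smul_right, hρ.1 x y, hv.1 x y, Complex.conj_ofReal]
  · have h2 : ∀ y ∈ Metric.sphere (0 : H) 1, 0 < (inner ℂ y ((ρ + t • v) y)).re := fun y hy => by
      have hy' : ‖y‖ = 1 := by simpa using hy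
      have h3 := hcx y hy
      have h4 : |(inner ℂ y (v y)).re| ≤ ‖v‖ := by
        refine (Complex.abs_re_le_norm _).trans ((norm_inner_le_norm _ _).trans ?_)
        have := v.le_opNorm y
        rw [hy'] at *
        linarith
      have h5 : |t * (inner ℂ y (v y)).re| ≤ |t| * ‖v‖ := by
        rw [abs_mul]; gcongr
      simp only [add_apply, hsm, inner_add_right, inner_smul_right,
        Complex.add_re, Complex.re_ofReal_mul]
      have := (abs_le.1 h5).1
      linarith
    have hx' : 0 < ‖x‖ := norm_pos_iff.2 hx
    have h3 := h2 (((‖x‖⁻¹ : ℝ) : ℂ) • x) (by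
      simp [norm_smul, hx'.ne'])
    rw [map_smul, inner_smul_left, inner_smul_right, Complex.conj_ofReal,
      Complex.re_ofReal_mul, Complex.re_ofReal_mul] at h3
    have h4 : 0 < ‖x‖⁻¹ := inv_pos.2 hx'
    exact (pos_iff_pos_of_mul_pos h3).1 h4 |> fun h => (mul_pos_iff_of_pos_left h4).1 h
  · rw [tr_add, tr_smul, hρ.2.2, hv.2]; simp

end Proofs

/-! ### The information-geometric structure on the space of states -/

section Connections

variable {H : Type*} [NormedAddCommGroup H] [InnerProductSpace ℂ H] [FiniteDimensional ℂ H]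

/-- Smooth vector fields on `states H`, in the representation `ρ ↦ ι_* (X_ρ)`
(only the values on `states H` matter). -/
def IsVectorField (Y : Op H → Op H) : Prop :=
  ContDiffOn ℝ ∞ Y (states H) ∧ ∀ ρ ∈ states H, Y ρ ∈ tangent H

/-- The m-connection `∇^(m)_v Y` at `ρ`: the flat connection `ι_* (∇^(m)_X Y) = X (ι_* Y)`. -/
def mCov (Y : Op H → Op H) (ρ v : Op H) : Op H := lineDeriv ℝ Y ρ v

/-- `w` is the covariant derivative of the vector field `Y` at `ρ` in the direction `v` for the
connection dual to the m-connection with respect to the SLD metric: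
`v g (Y, Z) = g (w, Z) + g (Y, ∇^(m)_v Z)` for every vector field `Z`. -/
def IsECov (Y : Op H → Op H) (ρ v w : Op H) : Prop :=
  w ∈ tangent H ∧ ∀ Z : Op H → Op H, IsVectorField Z →
    lineDeriv ℝ (fun σ => metric σ (Y σ) (Z σ)) ρ v =
      metric ρ w (Z ρ) + metric ρ (Y ρ) (mCov Z ρ v)

open Classical in
/-- The e-connection `∇^(e)_v Y` at `ρ`, the dual of the m-connection with respect to the SLD
metric (see `isECov_eCov` and `IsECov.unique`). -/
def eCov (Y : Op H → Op H) (ρ v : Op H) : Op H :=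
  if h : ∃ w, IsECov Y ρ v w then h.choose else 0

theorem tangent_sub {A B : Op H} (hA : A ∈ tangent H) (hB : B ∈ tangent H) :
    A - B ∈ tangent H := by
  refine ⟨fun x y => ?_, ?_⟩
  · simp only [sub_apply, inner_sub_left, inner_sub_right, hA.1 x y, hB.1 x y]
  · have h1 : tr A = tr (A - B) + tr B := by rw [← tr_add, sub_add_cancel]
    rw [hA.2, hB.2] at h1
    simpa using h1.symm

theorem IsECov.unique {Y : Op H → Op H} {ρ v w w' : Op H} (hρ : ρ ∈ states H)
    (h : IsECov Y ρ v w) (h' : IsECov Y ρ v w') : w = w' := by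
  have ht := tangent_sub h.1 h'.1
  have hZ : IsVectorField (fun _ : Op H => w - w') := ⟨contDiffOn_const, fun _ _ => ht⟩
  have h1 := (h.2 _ hZ).symm.trans (h'.2 _ hZ)
  have h2 : metric ρ w (w - w') = metric ρ w' (w - w') := by simpa using h1
  refine sub_eq_zero.1 (eq_zero_of_metric hρ ht.1 ?_)
  rw [metric_eq hρ ht.1 ht.1, sub_mul, map_sub, ← metric_eq hρ h.1.1 ht.1,
    ← metric_eq hρ h'.1.1 ht.1, h2, sub_self]

theorem tangent_smul (t : ℝ) {A : Op H} (hA : A ∈ tangent H) : t • A ∈ tangent H := by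
  have hsm : ∀ x, (t • A : Op H) x = (t : ℂ) • A x := fun x => rfl
  refine ⟨fun x y => ?_, ?_⟩
  · simp only [hsm, inner_smul_left, inner_smul_right, hA.1 x y, Complex.conj_ofReal]
  · rw [tr_smul, hA.2, mul_zero]

theorem hermitian_sub {A B : Op H} (hA : A ∈ hermitian H) (hB : B ∈ hermitian H) :
    A - B ∈ hermitian H := fun x y => by
  simp only [sub_apply, inner_sub_left, inner_sub_right, hA x y, hB x y]

theorem hermitian_smul (t : ℝ) {A : Op H} (hA : A ∈ hermitian H) : t • A ∈ hermitian H := by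
  have hsm : ∀ x, (t • A : Op H) x = (t : ℂ) • A x := fun x => rfl
  intro x y
  simp only [hsm, inner_smul_left, inner_smul_right, hA x y, Complex.conj_ofReal]

theorem isClosed_tangent : IsClosed (tangent H) := by
  refine isClosed_hermitian.inter (isClosed_eq ?_ continuous_const)
  exact LinearMap.continuous_of_finiteDimensional
    ((LinearMap.trace ℂ H).comp (ContinuousLinearMap.coeLM ℂ : Op H →ₗ[ℂ] (H →ₗ[ℂ] H)))

theorem deriv_mem {C : Set (Op H)} (hC : IsClosed C)
    (hsub : ∀ {A B : Op H}, A ∈ C → B ∈ C → A - B ∈ C)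
    (hsmul : ∀ (t : ℝ) {A : Op H}, A ∈ C → t • A ∈ C)
    {c : ℝ → Op H} {c' : Op H} (hc : HasDerivAt c c' 0) (hm : ∀ᶠ t in 𝓝 (0 : ℝ), c t ∈ C) :
    c' ∈ C := by
  refine hC.mem_of_tendsto (hasDerivAt_iff_tendsto_slope.1 hc) ?_
  filter_upwards [hm.filter_mono nhdsWithin_le_nhds] with t ht
  exact hsmul _ (hsub ht hm.self_of_nhds)

/-- Along a line through `ρ`, a smooth vector field is differentiable and its derivative is
tangent. -/
theorem hasDerivAt_field {Y : Op H → Op H} (hY : IsVectorField Y) {ρ v : Op H}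
    (hρ : ρ ∈ states H) (hv : v ∈ tangent H) :
    HasDerivAt (fun t : ℝ => Y (ρ + t • v)) (mCov Y ρ v) 0 ∧ mCov Y ρ v ∈ tangent H := by
  have hmem := eventually_mem_states hρ hv
  have hc : HasDerivAt (fun t : ℝ => ρ + t • v) v 0 := by
    simpa using ((hasDerivAt_id (0 : ℝ)).smul_const v).const_add ρ
  have hd : DifferentiableWithinAt ℝ Y (states H) (ρ + (0 : ℝ) • v) := by
    simpa using hY.1.differentiableOn (by simp) ρ hρ
  have h1 : HasDerivAt (fun t : ℝ => Y (ρ + t • v))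
      (fderivWithin ℝ Y (states H) (ρ + (0 : ℝ) • v) v) 0 :=
    (hd.hasFDerivWithinAt.comp_hasDerivWithinAt (t := states H)
      (s := {t : ℝ | ρ + t • v ∈ states H}) (0 : ℝ) hc.hasDerivWithinAt
      (fun t ht => ht)).hasDerivAt hmem
  have h2 : HasDerivAt (fun t : ℝ => Y (ρ + t • v)) (mCov Y ρ v) 0 := by
    rw [mCov, lineDeriv, h1.deriv]; exact h1
  exact ⟨h2, deriv_mem isClosed_tangent tangent_sub tangent_smul h2
    (hmem.mono fun t ht => hY.2 _ ht)⟩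

/-- The e-covariant derivative exists. -/
theorem isECov_eCov {Y : Op H → Op H} (hY : IsVectorField Y) {ρ v : Op H}
    (hρ : ρ ∈ states H) (hv : v ∈ tangent H) : IsECov Y ρ v (eCov Y ρ v) := by
  haveI := FiniteDimensional.complete ℂ H
  haveI : FiniteDimensional ℝ (Op H) := FiniteDimensional.complexToReal (Op H)
  haveI : CompleteSpace (Op H) := FiniteDimensional.complete ℝ (Op H)
  suffices h : ∃ w, IsECov Y ρ v w by
    rw [eCov, dif_pos h]
    exact h.choose_spec
  have hmem := eventually_mem_states hρ hv
  have hc : HasDerivAt (fun t : ℝ => ρ + t • v) v 0 := by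
    simpa using ((hasDerivAt_id (0 : ℝ)).smul_const v).const_add ρ
  obtain ⟨N', hN⟩ : ∃ N', HasDerivAt
      (fun t : ℝ => sld (ρ + t • v) (Y (ρ + t • v))) N' 0 := by
    have h0 : ρ + (0 : ℝ) • v = ρ := by simp
    obtain ⟨u, hu⟩ := isUnit_omega hρ
    have h1 : DifferentiableAt ℝ Ring.inverse (omega H (ρ + (0 : ℝ) • v)) := by
      rw [h0, ← hu]
      exact differentiableAt_inverse u.isUnit
    have h2 : DifferentiableAt ℝ (fun t : ℝ => omega H (ρ + t • v)) 0 :=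
      (omega H).differentiableAt.comp (0 : ℝ) hc.differentiableAt
    have h3 : DifferentiableAt ℝ
        (fun t : ℝ => Ring.inverse (omega H (ρ + t • v)) (Y (ρ + t • v))) 0 :=
      (DifferentiableAt.comp (0 : ℝ) h1 h2).clm_apply
        (hasDerivAt_field hY hρ hv).1.differentiableAt
    refine ⟨_, (h3.congr_of_eventuallyEq ?_).hasDerivAt⟩
    filter_upwards [hmem] with t ht
    exact sld_eq_inverse ht (hY.2 _ ht).1
  have hN' : N' ∈ hermitian H := deriv_mem isClosed_hermitian hermitian_sub hermitian_smul hN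
    (hmem.mono fun t ht => (isSLD_sld ht (hY.2 _ ht).1).1)
  have h1 : (1 : Op H) ∈ hermitian H := fun x y => rfl
  set c : ℝ := (tr (ρ * N')).re with hcdef
  set K : Op H := N' - c • (1 : Op H) with hK
  have hKh : K ∈ hermitian H := hermitian_sub hN' (hermitian_smul c h1)
  have hwh : omega H ρ K ∈ hermitian H := by
    have hρ' := mem_hermitian_iff.1 hρ.1
    have hK' := mem_hermitian_iff.1 hKh
    rw [omega_apply]
    refine hermitian_smul _ (mem_hermitian_iff.2 ?_)
    rw [star_add, star_mul, star_mul, hρ', hK', add_comm]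
  have him : ∀ {A B : Op H}, A ∈ hermitian H → B ∈ hermitian H → (tr (A * B)).im = 0 := by
    intro A B hA hB
    have h3 := tr_star (A * B)
    rw [star_mul, mem_hermitian_iff.1 hA, mem_hermitian_iff.1 hB, tr_mul_comm] at h3
    exact Complex.conj_eq_iff_im.1 h3.symm
  have hwtr : tr (omega H ρ K) = 0 := by
    have h2 : tr (omega H ρ K) = tr (ρ * K) := by
      rw [omega_apply, tr_smul, tr_add, tr_mul_comm K ρ]; push_cast; ring
    refine Complex.ext ?_ ?_
    · have h3 : ρ * N' = ρ * K + c • ρ := by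
        rw [hK, mul_sub, mul_smul_comm, mul_one, sub_add_cancel]
      have h4 := congrArg tr h3
      rw [tr_add, tr_smul, hρ.2.2, mul_one] at h4
      have h5 := congrArg Complex.re h4
      rw [Complex.add_re, Complex.ofReal_re, ← hcdef] at h5
      rw [h2, Complex.zero_re]
      linarith
    · rw [h2]; exact him hρ.1 hKh
  refine ⟨omega H ρ K, ⟨hwh, hwtr⟩, fun Z hZ => ?_⟩
  have hsldw : sld ρ (omega H ρ K) = K :=
    (isSLD_sld hρ hwh).unique hρ (isSLD_of_omega hρ hwh rfl)
  obtain ⟨hZd, hZt⟩ := hasDerivAt_field hZ hρ hv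
  have h2 : HasDerivAt (fun t : ℝ => reTr H (Z (ρ + t • v) * sld (ρ + t • v) (Y (ρ + t • v))))
      (reTr H (mCov Z ρ v * sld (ρ + (0 : ℝ) • v) (Y (ρ + (0 : ℝ) • v)) +
        Z (ρ + (0 : ℝ) • v) * N')) 0 :=
    (reTr H).hasFDerivAt.comp_hasDerivAt (0 : ℝ) (hZd.mul hN)
  have h3 : lineDeriv ℝ (fun σ => metric σ (Y σ) (Z σ)) ρ v =
      reTr H (mCov Z ρ v * sld ρ (Y ρ) + Z ρ * N') := by
    rw [zero_smul, add_zero] at h2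
    refine (h2.congr_of_eventuallyEq ?_).deriv
    filter_upwards [hmem] with t ht
    rw [metric_comm ht (hY.2 _ ht).1 (hZ.2 _ ht).1, metric_eq ht (hZ.2 _ ht).1 (hY.2 _ ht).1]
  have hZρ := hZ.2 _ hρ
  rw [h3, metric_comm hρ hwh hZρ.1, metric_eq hρ hZρ.1 hwh, hsldw,
    metric_comm hρ (hY.2 _ hρ).1 hZt.1, metric_eq hρ hZt.1 (hY.2 _ hρ).1, map_add, add_comm, hK,
    mul_sub, map_sub, mul_smul_comm, mul_one, map_smul, reTr_apply (Z ρ), hZρ.2]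
  simp

end Connections
/-! ### Models -/

section Models

variable (H : Type*) [NormedAddCommGroup H] [InnerProductSpace ℂ H] [FiniteDimensional ℂ H]

/-- An `n`-dimensional model `(M, ξ)`: a connected submanifold `M` of `states H` with a global
coordinate system `ξ : M → ℝⁿ`, given by the inverse `ξ ↦ ρ_ξ` of the coordinate system, which
is an injective immersion of a connected open set of `ℝⁿ`. -/
structure Model (n : ℕ) where
  /-- The range of the coordinate system. -/
  dom : Set (Fin n → ℝ)
  isOpen_dom : IsOpen dom
  isConnected_dom : IsConnected dom
  /-- The parametrization `ξ ↦ ρ_ξ`. -/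
  param : (Fin n → ℝ) → Op H
  contDiffOn_param : ContDiffOn ℝ ∞ param dom
  injOn_param : InjOn param dom
  immersion : ∀ x ∈ dom, Function.Injective (fderiv ℝ param x)
  param_mem : ∀ x ∈ dom, param x ∈ states H

variable {H}

namespace Model

variable {n : ℕ} (M : Model H n)

/-- The underlying set of the submanifold `M`. -/
def carrier : Set (Op H) := M.param '' M.dom

/-- A point of `M`, as a state. -/
def toState (p : M.carrier) : states H :=
  ⟨p.1, by obtain ⟨x, hx, hp⟩ := p.2; exact hp ▸ M.param_mem x hx⟩

/-- The coordinate system `ξ : M → ℝⁿ`. -/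
def coord (p : M.carrier) : Fin n → ℝ :=
  ((Equiv.Set.imageOfInjOn M.param M.dom M.injOn_param).symm p : M.dom)

open Classical in
/-- The coordinate expression `x ↦ f (ρ_x)` of a function `f` on `M` (zero outside `dom`). -/
def rep (f : M.carrier → ℝ) (x : Fin n → ℝ) : ℝ :=
  if hx : x ∈ M.dom then f ⟨M.param x, mem_image_of_mem _ hx⟩ else 0

/-- Smooth functions on `M`. -/
def IsSmooth (f : M.carrier → ℝ) : Prop := ContDiffOn ℝ ∞ (M.rep f) M.dom

/-- The partial derivative `∂_i f = ∂f/∂ξ^i` of a function on `M`, at the point with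
coordinates `x`. -/
def partialDeriv (i : Fin n) (f : M.carrier → ℝ) (x : Fin n → ℝ) : ℝ :=
  fderiv ℝ (M.rep f) x (Pi.single i 1)

/-- Smooth vector fields on `M`, in coordinates: `X = ∑ X^i ∂_i`. -/
def IsField (X : (Fin n → ℝ) → (Fin n → ℝ)) : Prop := ContDiffOn ℝ ∞ X M.dom

/-- The coordinate vector field `∂_i`. -/
def basisField (i : Fin n) : (Fin n → ℝ) → (Fin n → ℝ) := fun _ => Pi.single i 1

/-- The vector field `X` on `M` regarded as a section of the tangent bundle of `states H` along
`M`: `x ↦ ι_* (X_{ρ_x})`. -/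
def push (X : (Fin n → ℝ) → (Fin n → ℝ)) (x : Fin n → ℝ) : Op H := fderiv ℝ M.param x (X x)

/-- The Gram matrix `g_ij = g (∂_i, ∂_j)` of the SLD metric (the SLD Fisher information matrix). -/
def gram (x : Fin n → ℝ) : Matrix (Fin n) (Fin n) ℝ :=
  Matrix.of fun i j =>
    metric (M.param x) (M.push (basisField i) x) (M.push (basisField j) x)

/-- The squared norm `‖(df)_ρ‖² = ∑ g^ij ∂_i f ∂_j f` of the differential of `f`. -/
def normSqD (f : M.carrier → ℝ) (x : Fin n → ℝ) : ℝ :=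
  ∑ i, ∑ j, (M.gram x)⁻¹ i j * M.partialDeriv i f x * M.partialDeriv j f x

/-- `w` is the value at the point with coordinates `x` of `∇^(e)_X Y`, where `X` is a vector
field on `M` and `Y` is a section along `M` of the tangent bundle of `states H`. It is computed,
as usual, from any vector field on `states H` that agrees with `Y` on `M` near the point. -/
def IsECovAlong (X : (Fin n → ℝ) → (Fin n → ℝ)) (Y : (Fin n → ℝ) → Op H) (x : Fin n → ℝ)
    (w : Op H) : Prop :=
  ∃ Y' : Op H → Op H, IsVectorField Y' ∧ (∀ᶠ y in 𝓝 x, Y' (M.param y) = Y y) ∧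
    w = eCov Y' (M.param x) (M.push X x)

/-- `M` is e-autoparallel in `states H`: `∇^(e)_X Y` is a vector field on `M` for all vector
fields `X`, `Y` on `M`. -/
def EAutoparallel : Prop :=
  ∀ X Y, M.IsField X → M.IsField Y →
    ∃ W, M.IsField W ∧ ∀ x ∈ M.dom, M.IsECovAlong X (M.push Y) x (M.push W x)

/-- `W = (∇^(m)_M)_X Z` for the m-connection of `M`, which is the dual, with respect to the
induced metric, of the connection that `∇^(e)` induces on `M`:
`X g (Y, Z) = g (∇^(e)_X Y, Z) + g (Y, W)` for every vector field `Y` on `M`. -/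
def IsMCovOn (X Z W : (Fin n → ℝ) → (Fin n → ℝ)) : Prop :=
  M.IsField W ∧ ∀ Y, M.IsField Y → ∀ x ∈ M.dom, ∀ w, M.IsECovAlong X (M.push Y) x w →
    fderiv ℝ (fun y => metric (M.param y) (M.push Y y) (M.push Z y)) x (X x) =
      metric (M.param x) w (M.push Z x) + metric (M.param x) (M.push Y x) (M.push W x)

/-- The coordinate system of `M` is m-affine: the `∂_j` are parallel for the m-connection
of `M`. -/
def IsMAffine : Prop := ∀ i j, M.IsMCovOn (basisField i) (basisField j) 0

end Model

end Models

/-! ### Estimators -/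

section Estimators

variable (H : Type*) [NormedAddCommGroup H] [InnerProductSpace ℂ H] [FiniteDimensional ℂ H]

/-- A POVM on the Borel sets of `ℝ`, that is, an estimator for a scalar quantity. -/
structure POVM where
  effect : VectorMeasure ℝ (Op H)
  isPositive : ∀ B, MeasurableSet B → (effect B).IsPositive
  total : effect univ = 1

variable {H}

/-- The distribution `Tr (ρ Λ(dt))` of the estimate in the state `ρ`. -/
def POVM.dist (Λ : POVM H) (ρ : states H) : Measure ℝ :=
  Measure.ofMeasurable (fun B _ => ENNReal.ofReal (tr (ρ.1 * Λ.effect B)).re)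
    (by simp [tr])
    (by
      intro B hB hd
      have h1 : HasSum (fun i => (tr (ρ.1 * Λ.effect (B i))).re)
          (tr (ρ.1 * Λ.effect (⋃ i, B i))).re :=
        ((reTr H).comp (ContinuousLinearMap.mul ℝ (Op H) ρ.1)).hasSum (Λ.effect.m_iUnion hB hd)
      rw [← h1.tsum_eq]
      exact ENNReal.ofReal_tsum_of_nonneg
        (fun i => tr_mul_nonneg (isPositive_of_mem_states ρ.2) (Λ.isPositive _ (hB i)))
        h1.summable)

/-- The expectation `E_ρ (Λ)`. -/
def POVM.mean (Λ : POVM H) (ρ : states H) : ℝ := ∫ t, t ∂(Λ.dist ρ)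

/-- The mean squared error of `Λ` in the state `ρ` about the value `c`. -/
def POVM.mse (Λ : POVM H) (ρ : states H) (c : ℝ) : ENNReal :=
  ∫⁻ t, ENNReal.ofReal ((t - c) ^ 2) ∂(Λ.dist ρ)

namespace Model

variable {n : ℕ} (M : Model H n)

/-- `Λ` is locally unbiased for `f` at the point `p` of `M`: `E_p (Λ) = f p` and
`(d E (Λ))_p = (df)_p` (where the expectations exist). -/
def IsLocallyUnbiased (Λ : POVM H) (f : M.carrier → ℝ) (p : M.carrier) : Prop :=
  (∀ q, Integrable (fun t : ℝ => t) (Λ.dist (M.toState q))) ∧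
  Λ.mean (M.toState p) = f p ∧
  ∀ i, M.partialDeriv i (fun q => Λ.mean (M.toState q)) (M.coord p) =
    M.partialDeriv i f (M.coord p)

/-- `Λ` is efficient for `f`: at every point it is locally unbiased and its mean squared error
is `‖df‖²`. -/
def IsEfficient (Λ : POVM H) (f : M.carrier → ℝ) : Prop :=
  ∀ p, M.IsLocallyUnbiased Λ f p ∧
    Λ.mse (M.toState p) (f p) = ENNReal.ofReal (M.normSqD f (M.coord p))

/-- The set `E(M)` of smooth functions on `M` that admit an efficient estimator. -/
def effFunctions : Set (M.carrier → ℝ) := {f | M.IsSmooth f ∧ ∃ Λ : POVM H, M.IsEfficient Λ f}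

end Model

end Estimators

end QuantumModel

end

noncomputable section

namespace QuantumModel

/-! ### Smoothness of the SLD and the e-covariant derivative along a curve -/

section SLD

variable {H : Type*} [NormedAddCommGroup H] [InnerProductSpace ℂ H] [FiniteDimensional ℂ H]
  [CompleteSpace H]
variable {E : Type*} [NormedAddCommGroup E] [NormedSpace ℝ E]

/-! Write L_v for the SLD of v and grad f for the gradient of f on M with respect to the induced
metric. Two facts carry the proof. Estimation. A POVM with finite second moment has a mean operator
A, whose second moment is at most that of the POVM (`POVM.exists_mean_operator`). The equality case
of the SLD Cramér-Rao inequality (`Model.eq_score_of_reTr_sq_le`) then turns efficiency for f into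
an operator equation: one Hermitian A satisfies A - f(ρ) = L_{grad f} at every ρ in M. Conversely,
the spectral measure of such an A is efficient. This is `Model.mem_effFunctions_iff`. Geometry.
Duality with the flat m-connection makes the SLD of ∇^(e)_X Y the centered derivative of L_Y along X
(`sld_eCov`). On a model the mean to be removed is -g(X, Y), because L_Y has mean zero everywhere
(`Model.IsECovAlong.sld_eq_fderiv_score`). Given (ii), there are fixed observables A^i with A^i -
ξ^i = L_{grad ξ^i}. Differentiation leaves only a scalar, which centering removes, so the grad ξ^i
form an e-parallel frame of M. Hence M is e-autoparallel, and the dual frame ∂_j is m-parallel.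
Given (i), the constancy of g(grad ξ^i, ∂_j) makes grad ξ^i e-parallel, so L_{grad ξ^i} + ξ^i has
zero derivative and is a constant operator A^i by connectedness. For (iii), c + Σ u_i A^i estimates
c + Σ u_i ξ^i. If B - f = Σ ∂_i f (A^i - ξ^i), differentiation gives Σ_i ∂_k ∂_i f (A^i - ξ^i) = 0;
independence of the SLDs makes the Hessian vanish, so f is affine in ξ. -/

theorem contDiffOn_sld {s : Set E} {p Y : E → Op H} (hp : ContDiffOn ℝ ∞ p s)
    (hps : ∀ x ∈ s, p x ∈ states H) (hY : ContDiffOn ℝ ∞ Y s) (hYs : ∀ x ∈ s, Y x ∈ hermitian H) :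
    ContDiffOn ℝ ∞ (fun x => sld (p x) (Y x)) s := by
  refine ContDiffOn.congr (f := fun x => Ring.inverse (omega H (p x)) (Y x)) (fun x hx => ?_)
    fun x hx => sld_eq_inverse (hps x hx) (hYs x hx)
  refine ContDiffWithinAt.clm_apply ?_ (hY x hx)
  obtain ⟨u, hu⟩ := isUnit_omega (hps x hx)
  have h1 : ContDiffAt ℝ ∞ Ring.inverse (omega H (p x)) := by
    rw [← hu]
    exact contDiffAt_ringInverse ℝ u
  exact h1.comp_contDiffWithinAt x ((omega H).contDiff.comp_contDiffWithinAt (hp x hx))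

theorem contDiffOn_metric {s : Set E} {p Y Z : E → Op H} (hp : ContDiffOn ℝ ∞ p s)
    (hps : ∀ x ∈ s, p x ∈ states H) (hY : ContDiffOn ℝ ∞ Y s) (hYs : ∀ x ∈ s, Y x ∈ hermitian H)
    (hZ : ContDiffOn ℝ ∞ Z s) (hZs : ∀ x ∈ s, Z x ∈ hermitian H) :
    ContDiffOn ℝ ∞ (fun x => metric (p x) (Y x) (Z x)) s :=
  ((reTr H).contDiff.comp_contDiffOn (hY.mul (contDiffOn_sld hp hps hZ hZs))).congr
    fun x hx => metric_eq (hps x hx) (hYs x hx) (hZs x hx)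

theorem one_mem_hermitian : (1 : Op H) ∈ hermitian H := fun _ _ => rfl

theorem omega_mem_hermitian {ρ K : Op H} (hρ : ρ ∈ hermitian H) (hK : K ∈ hermitian H) :
    omega H ρ K ∈ hermitian H := by
  rw [omega_apply]
  refine hermitian_smul _ (mem_hermitian_iff.2 ?_)
  rw [star_add, star_mul, star_mul, mem_hermitian_iff.1 hρ, mem_hermitian_iff.1 hK, add_comm]

theorem im_tr_eq_zero {A : Op H} (hA : A ∈ hermitian H) : (tr A).im = 0 := by
  have h := tr_star A
  rw [mem_hermitian_iff.1 hA] at h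
  exact Complex.conj_eq_iff_im.1 h.symm

theorem tr_omega (ρ K : Op H) : tr (omega H ρ K) = tr (ρ * K) := by
  rw [omega_apply, tr_smul, tr_add, tr_mul_comm K ρ]
  push_cast
  ring

/-- The SLD of a tangent vector has mean zero. -/
theorem reTr_mul_sld {ρ v : Op H} (hρ : ρ ∈ states H) (hv : v ∈ tangent H) :
    reTr H (ρ * sld ρ v) = 0 := by
  rw [reTr_apply, ← tr_omega, omega_sld hρ hv.1, hv.2, Complex.zero_re]

theorem sld_omega {ρ K : Op H} (hρ : ρ ∈ states H) (hK : K ∈ hermitian H) :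
    sld ρ (omega H ρ K) = K :=
  (isSLD_sld hρ (omega_mem_hermitian hρ.1 hK)).unique hρ
    (isSLD_of_omega hρ (omega_mem_hermitian hρ.1 hK) rfl)

/-- Subtracting the mean makes the trace vanish, since Tr Ω_ρ(K) = Tr(ρK) and Tr ρ = 1. Thus
centered Hermitian operators are SLDs of tangent vectors. -/
theorem omega_centered_mem_tangent {ρ N : Op H} (hρ : ρ ∈ states H) (hN : N ∈ hermitian H) :
    omega H ρ (N - reTr H (ρ * N) • (1 : Op H)) ∈ tangent H := by
  have hK : N - reTr H (ρ * N) • (1 : Op H) ∈ hermitian H :=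
    hermitian_sub hN (hermitian_smul _ one_mem_hermitian)
  refine ⟨omega_mem_hermitian hρ.1 hK, Complex.ext ?_ (im_tr_eq_zero (omega_mem_hermitian hρ.1 hK))⟩
  have h1 : reTr H (ρ * (N - reTr H (ρ * N) • (1 : Op H))) = 0 := by
    have h2 : reTr H ρ = 1 := by rw [reTr_apply, hρ.2.2, Complex.one_re]
    rw [mul_sub, mul_smul_comm, mul_one, map_sub, map_smul, h2, smul_eq_mul, mul_one, sub_self]
  rw [tr_omega]
  exact h1

/-- In terms of SLDs, the e-covariant derivative is the centered derivative, which may be computed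
along any curve in `states H`. -/
theorem sld_eCov {Y : Op H → Op H} (hY : IsVectorField Y) {γ : ℝ → Op H} {v N : Op H}
    (hγ : HasDerivAt γ v 0) (hγs : ∀ᶠ t in 𝓝 (0 : ℝ), γ t ∈ states H) (hv : v ∈ tangent H)
    (hN : HasDerivAt (fun t => sld (γ t) (Y (γ t))) N 0) :
    eCov Y (γ 0) v ∈ tangent H ∧
      sld (γ 0) (eCov Y (γ 0) v) = N - reTr H (γ 0 * N) • (1 : Op H) := by
  have hρ : γ 0 ∈ states H := hγs.self_of_nhds
  -- Only a derivative within `states H` is available, as that set is not open among all operators.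
  -- It suffices, because the chain rule is applied only to curves staying in the set.
  have hF : DifferentiableWithinAt ℝ (fun σ => sld σ (Y σ)) (states H) (γ 0) :=
    (contDiffOn_sld contDiffOn_id (fun x hx => hx) hY.1 fun x hx => (hY.2 x hx).1).differentiableOn
      (by simp) _ hρ
  set F' := fderivWithin ℝ (fun σ => sld σ (Y σ)) (states H) (γ 0) with hF'
  have key : ∀ c : ℝ → Op H, HasDerivAt c v 0 → c 0 = γ 0 → (∀ᶠ t in 𝓝 (0 : ℝ), c t ∈ states H) →
      HasDerivAt (fun t => sld (c t) (Y (c t))) (F' v) 0 := by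
    intro c hc hc0 hcs
    have h1 : HasFDerivWithinAt (fun σ => sld σ (Y σ)) F' (states H) (c 0) := by
      rw [hc0]; exact hF.hasFDerivWithinAt
    exact (h1.comp_hasDerivWithinAt (t := states H) (s := {t : ℝ | c t ∈ states H}) (0 : ℝ)
      hc.hasDerivWithinAt (fun t ht => ht)).hasDerivAt hcs
  have hN' : N = F' v := hN.unique (key γ hγ rfl hγs)
  have hlin : HasDerivAt (fun t : ℝ => sld (γ 0 + t • v) (Y (γ 0 + t • v))) N 0 := by
    rw [hN']
    refine key (fun t => γ 0 + t • v) ?_ (by simp) (eventually_mem_states hρ hv)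
    simpa using ((hasDerivAt_id (0 : ℝ)).smul_const v).const_add (γ 0)
  have hNh : N ∈ hermitian H := deriv_mem isClosed_hermitian hermitian_sub hermitian_smul hN
    (hγs.mono fun t ht => (isSLD_sld ht (hY.2 _ ht).1).1)
  obtain ⟨hw, hdual⟩ := isECov_eCov hY hρ hv
  set w := eCov Y (γ 0) v
  set K : Op H := N - reTr H (γ 0 * N) • (1 : Op H) with hK
  have hKh : K ∈ hermitian H := hermitian_sub hNh (hermitian_smul _ one_mem_hermitian)
  have hKt : omega H (γ 0) K ∈ tangent H := omega_centered_mem_tangent hρ hNh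
  refine ⟨hw, ?_⟩
  suffices h : w = omega H (γ 0) K by rw [h, sld_omega hρ hKh]
  -- The duality is tested against the constant field equal to the difference to be killed: its
  -- m-derivative vanishes, and its zero trace makes the centering term invisible. Definiteness of
  -- the metric concludes.
  have hZ := tangent_sub hw hKt
  set Z := w - omega H (γ 0) K with hZdef
  have h1 := hdual (fun _ => Z) ⟨contDiffOn_const, fun _ _ => hZ⟩
  have h2 : mCov (fun _ : Op H => Z) (γ 0) v = 0 := by simp [mCov, lineDeriv]
  have h3 : metric (γ 0) (Y (γ 0)) 0 = 0 := by
    have h0 : (0 : Op H) ∈ hermitian H := by simpa using hermitian_smul (0 : ℝ) hZ.1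
    rw [metric_comm hρ (hY.2 _ hρ).1 h0, metric_eq hρ h0 (hY.2 _ hρ).1, zero_mul, map_zero]
  have h4 : lineDeriv ℝ (fun σ => metric σ (Y σ) Z) (γ 0) v = reTr H (Z * N) := by
    have h5 : HasDerivAt (fun t : ℝ => reTr H (Z * sld (γ 0 + t • v) (Y (γ 0 + t • v))))
        (reTr H (Z * N)) 0 :=
      (reTr H).hasFDerivAt.comp_hasDerivAt (0 : ℝ) (hlin.const_mul Z)
    refine (h5.congr_of_eventuallyEq ?_).deriv
    filter_upwards [eventually_mem_states hρ hv] with t ht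
    rw [metric_comm ht (hY.2 _ ht).1 hZ.1, metric_eq ht hZ.1 (hY.2 _ ht).1]
  rw [h4, h2, h3, add_zero] at h1
  have h6 : metric (γ 0) (omega H (γ 0) K) Z = reTr H (Z * N) := by
    rw [metric_comm hρ hKt.1 hZ.1, metric_eq hρ hZ.1 hKt.1, sld_omega hρ hKh, hK, mul_sub,
      mul_smul_comm, mul_one, map_sub, map_smul, reTr_apply Z, hZ.2]
    simp
  refine sub_eq_zero.1 (eq_zero_of_metric hρ hZ.1 ?_)
  change metric (γ 0) Z Z = 0
  nth_rewrite 1 [hZdef]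
  rw [metric_eq hρ hZ.1 hZ.1, sub_mul, map_sub, ← metric_eq hρ hw.1 hZ.1,
    ← metric_eq hρ hKt.1 hZ.1, h6, h1, sub_self]

end SLD

/-! ### Geometry of a model -/

namespace Model

variable {H : Type*} [NormedAddCommGroup H] [InnerProductSpace ℂ H] [FiniteDimensional ℂ H]
  [CompleteSpace H] {n : ℕ} (M : Model H n)

theorem contDiffAt_param {x : Fin n → ℝ} (hx : x ∈ M.dom) : ContDiffAt ℝ ∞ M.param x :=
  M.contDiffOn_param.contDiffAt (M.isOpen_dom.mem_nhds hx)

theorem hasFDerivAt_param {x : Fin n → ℝ} (hx : x ∈ M.dom) :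
    HasFDerivAt M.param (fderiv ℝ M.param x) x :=
  ((M.contDiffAt_param hx).differentiableAt (by simp)).hasFDerivAt

theorem hasDerivAt_line (x v : Fin n → ℝ) : HasDerivAt (fun t : ℝ => x + t • v) v 0 := by
  simpa using ((hasDerivAt_id (0 : ℝ)).smul_const v).const_add x

theorem eventually_line_mem {x : Fin n → ℝ} {s : Set (Fin n → ℝ)} (hs : s ∈ 𝓝 x)
    (v : Fin n → ℝ) : ∀ᶠ t in 𝓝 (0 : ℝ), x + t • v ∈ s := by
  have h := (hasDerivAt_line x v).continuousAt.tendsto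
  simp only [zero_smul, add_zero] at h
  exact h hs

theorem hasDerivAt_comp_line {F : Type*} [NormedAddCommGroup F] [NormedSpace ℝ F]
    {f : (Fin n → ℝ) → F} {f' : (Fin n → ℝ) →L[ℝ] F} {x : Fin n → ℝ} (hf : HasFDerivAt f f' x)
    (v : Fin n → ℝ) : HasDerivAt (fun t : ℝ => f (x + t • v)) (f' v) 0 := by
  have hf0 : HasFDerivAt f f' (x + (0 : ℝ) • v) := by simpa using hf
  exact hf0.comp_hasDerivAt (0 : ℝ) (hasDerivAt_line x v)

theorem fderiv_param_mem {x : Fin n → ℝ} (hx : x ∈ M.dom) (v : Fin n → ℝ) :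
    fderiv ℝ M.param x v ∈ tangent H := by
  refine deriv_mem isClosed_tangent tangent_sub tangent_smul
    -- States form an affine set; subtracting the base point moves the curve into the closed linear
    -- space of tangent vectors, which contains its velocity.
    ((hasDerivAt_comp_line (M.hasFDerivAt_param hx) v).sub_const (M.param x)) ?_
  filter_upwards [eventually_line_mem (M.isOpen_dom.mem_nhds hx) v] with t ht
  have h1 := M.param_mem _ ht
  have h2 := M.param_mem _ hx
  refine ⟨hermitian_sub h1.1 h2.1, ?_⟩
  have h3 : tr (M.param (x + t • v)) = tr (M.param (x + t • v) - M.param x) + tr (M.param x) := by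
    rw [← tr_add, sub_add_cancel]
  rw [h1.2.2, h2.2.2] at h3
  simpa using h3.symm

theorem contDiffOn_push {X : (Fin n → ℝ) → (Fin n → ℝ)} (hX : M.IsField X) :
    ContDiffOn ℝ ∞ (M.push X) M.dom :=
  (M.contDiffOn_param.fderiv_of_isOpen M.isOpen_dom (by simp)).clm_apply hX

variable {M} in
/-- In terms of SLDs, the e-covariant derivative along a model is the centered derivative. -/
theorem IsECovAlong.sld_eq {X : (Fin n → ℝ) → (Fin n → ℝ)} {Y : (Fin n → ℝ) → Op H}
    {x : Fin n → ℝ} {w : Op H} (h : M.IsECovAlong X Y x w) (hx : x ∈ M.dom)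
    {S : (Fin n → ℝ) →L[ℝ] Op H} (hS : HasFDerivAt (fun y => sld (M.param y) (Y y)) S x) :
    w ∈ tangent H ∧
      sld (M.param x) w = S (X x) - reTr H (M.param x * S (X x)) • (1 : Op H) := by
  obtain ⟨Y', hY', hYY', rfl⟩ := h
  have h0 : M.param x = M.param (x + (0 : ℝ) • X x) := by simp
  have h1 := sld_eCov (N := S (X x)) hY' (hasDerivAt_comp_line (M.hasFDerivAt_param hx) (X x))
    ((eventually_line_mem (M.isOpen_dom.mem_nhds hx) (X x)).mono fun t ht => M.param_mem _ ht)
    (M.fderiv_param_mem hx _) (by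
      refine (hasDerivAt_comp_line hS (X x)).congr_of_eventuallyEq ?_
      filter_upwards [eventually_line_mem hYY' (X x)] with t ht
      rw [show Y' (M.param (x + t • X x)) = Y (x + t • X x) from ht])
  rw [← h0] at h1
  exact h1

/-- A vector field on a model extends, near each point, to a vector field on `states H`. -/
theorem exists_extension {X : (Fin n → ℝ) → (Fin n → ℝ)} (hX : M.IsField X) {x : Fin n → ℝ}
    (hx : x ∈ M.dom) :
    ∃ Y : Op H → Op H, IsVectorField Y ∧ ∀ᶠ y in 𝓝 x, Y (M.param y) = M.push X y := by
  haveI : FiniteDimensional ℝ (Op H) := FiniteDimensional.complexToReal (Op H)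
  -- Composing the parametrization with a linear left inverse Q of its differential at x gives a
  -- local diffeomorphism e near x. Then e⁻¹ ∘ Q recovers the coordinates smoothly near the state,
  -- and the field is transported along it.
  obtain ⟨P, hP⟩ := LinearMap.exists_leftInverse_of_injective
    (fderiv ℝ M.param x : (Fin n → ℝ) →ₗ[ℝ] Op H) (LinearMap.ker_eq_bot.2 (M.immersion x hx))
  set Q : Op H →L[ℝ] (Fin n → ℝ) := LinearMap.toContinuousLinearMap P with hQ
  have hq : ∀ y ∈ M.dom, ContDiffAt ℝ ∞ (Q ∘ M.param) y := fun y hy =>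
    Q.contDiff.contDiffAt.comp y (M.contDiffAt_param hy)
  have hq' : ∀ y ∈ M.dom, HasFDerivAt (Q ∘ M.param) (Q ∘L fderiv ℝ M.param y) y := fun y hy =>
    Q.hasFDerivAt.comp y (M.hasFDerivAt_param hy)
  have hid : Q ∘L fderiv ℝ M.param x = ContinuousLinearMap.id ℝ (Fin n → ℝ) := by
    ext1 v
    exact congrArg (fun T : (Fin n → ℝ) →ₗ[ℝ] (Fin n → ℝ) => T v) hP
  have hstrict : HasStrictFDerivAt (Q ∘ M.param)
      ((ContinuousLinearEquiv.refl ℝ (Fin n → ℝ) : (Fin n → ℝ) ≃L[ℝ] (Fin n → ℝ)) :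
        (Fin n → ℝ) →L[ℝ] (Fin n → ℝ)) x := by
    have h1 := (hq x hx).hasStrictFDerivAt' (hq' x hx) (by simp)
    rw [hid] at h1
    exact h1
  set e := hstrict.toOpenPartialHomeomorph (Q ∘ M.param) with he
  have hxe : x ∈ e.source := hstrict.mem_toOpenPartialHomeomorph_source
  have hecoe : ∀ y, e y = Q (M.param y) := fun y => rfl
  -- The inverse function is shown smooth one point at a time, which needs an invertible
  -- differential at every nearby point and not just at x.
  set G : Set (Fin n → ℝ) := {y | y ∈ M.dom ∧ IsUnit (Q ∘L fderiv ℝ M.param y)} with hG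
  have hGx : G ∈ 𝓝 x := by
    have h1 : ContinuousAt (fun y => Q ∘L fderiv ℝ M.param y) x :=
      continuousAt_const.clm_comp (((M.contDiffOn_param.fderiv_of_isOpen M.isOpen_dom
        (m := ∞) (by simp)).continuousOn).continuousAt (M.isOpen_dom.mem_nhds hx))
    refine Filter.inter_mem (M.isOpen_dom.mem_nhds hx) (h1 (Units.isOpen.mem_nhds ?_))
    change IsUnit (Q ∘L fderiv ℝ M.param x)
    rw [hid]
    exact isUnit_one
  have hV : e.target ∩ e.symm ⁻¹' interior G ∈ 𝓝 (e x) :=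
    (e.isOpen_inter_preimage_symm isOpen_interior).mem_nhds
      ⟨e.map_source hxe, by
        rw [mem_preimage, e.left_inv hxe]; exact mem_interior_iff_mem_nhds.2 hGx⟩
  have hW : Q ⁻¹' (e.target ∩ e.symm ⁻¹' interior G) ∈ 𝓝 (M.param x) :=
    Q.continuous.continuousAt hV
  have hr : ∀ σ ∈ Q ⁻¹' (e.target ∩ e.symm ⁻¹' interior G),
      e.symm (Q σ) ∈ M.dom ∧ ContDiffAt ℝ ∞ (fun σ => e.symm (Q σ)) σ := by
    intro σ hσ
    obtain ⟨hd, u, hu⟩ := interior_subset hσ.2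
    refine ⟨hd, ContDiffAt.comp σ ?_ Q.contDiff.contDiffAt⟩
    refine e.contDiffAt_symm hσ.1 (f₀' := ContinuousLinearEquiv.unitsEquiv ℝ _ u) ?_ (hq _ hd)
    have h2 : ((ContinuousLinearEquiv.unitsEquiv ℝ (Fin n → ℝ) u :
        (Fin n → ℝ) ≃L[ℝ] (Fin n → ℝ)) : (Fin n → ℝ) →L[ℝ] (Fin n → ℝ)) =
        Q ∘L fderiv ℝ M.param (e.symm (Q σ)) := by
      rw [← hu]; rfl
    rw [h2]
    exact hq' _ hd
  obtain ⟨ε, hε, hεW⟩ := Metric.nhds_basis_closedBall.mem_iff.1 hW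
  -- The cutoff equals 1 near the base state and has its support where e⁻¹ ∘ Q is smooth, so the
  -- extension by zero is a global smooth tangent field.
  let χ : ContDiffBump (M.param x) := ⟨ε / 2, ε, by positivity, by linarith⟩
  have hpushc : ∀ y ∈ M.dom, ContDiffAt ℝ ∞ (M.push X) y := fun y hy =>
    (M.contDiffOn_push hX).contDiffAt (M.isOpen_dom.mem_nhds hy)
  refine ⟨fun σ => χ σ • M.push X (e.symm (Q σ)), ⟨fun σ _ => ?_, fun σ _ => ?_⟩, ?_⟩
  · refine ContDiffAt.contDiffWithinAt ?_
    by_cases hσ : σ ∈ tsupport χ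
    · rw [χ.tsupport_eq] at hσ
      obtain ⟨h1, h2⟩ := hr σ (hεW hσ)
      exact χ.contDiffAt.smul (ContDiffAt.comp (g := M.push X) σ (hpushc _ h1) h2)
    · refine (contDiffAt_const (c := (0 : Op H))).congr_of_eventuallyEq ?_
      filter_upwards [notMem_tsupport_iff_eventuallyEq.1 hσ] with τ hτ
      simp [hτ]
  · by_cases hσ : σ ∈ Metric.closedBall (M.param x) ε
    · exact tangent_smul _ (M.fderiv_param_mem (hr σ (hεW hσ)).1 _)
    · have : χ σ = 0 := χ.zero_of_le_dist (le_of_lt (by simpa using hσ))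
      simp only [this]
      exact tangent_smul 0 (M.fderiv_param_mem hx 0) |> fun h => by simpa using h
  · have h1 : ∀ᶠ y in 𝓝 x, χ (M.param y) = 1 :=
      (M.hasFDerivAt_param hx).continuousAt.eventually χ.eventuallyEq_one
    filter_upwards [h1, e.open_source.mem_nhds hxe] with y hy1 hy2
    have h3 : e.symm (Q (M.param y)) = y := e.left_inv hy2
    rw [hy1, one_smul, h3]

theorem exists_isECovAlong (X : (Fin n → ℝ) → (Fin n → ℝ)) {Y : (Fin n → ℝ) → (Fin n → ℝ)}
    (hY : M.IsField Y) {x : Fin n → ℝ} (hx : x ∈ M.dom) :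
    ∃ w, M.IsECovAlong X (M.push Y) x w := by
  obtain ⟨Y', h1, h2⟩ := M.exists_extension hY hx
  exact ⟨_, Y', h1, h2, rfl⟩

end Model

/-! ### Smooth dependence of determinants and inverse matrices -/

theorem contDiffOn_det {E ι : Type*} [NormedAddCommGroup E] [NormedSpace ℝ E] [Fintype ι]
    [DecidableEq ι] {s : Set E} {A : E → Matrix ι ι ℝ}
    (hA : ∀ i j, ContDiffOn ℝ ∞ (fun x => A x i j) s) : ContDiffOn ℝ ∞ (fun x => (A x).det) s := by
  simp only [Matrix.det_apply]
  exact ContDiffOn.sum fun σ _ => (contDiffOn_prod fun i _ => hA (σ i) i).const_smul _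

/-- Cramer's rule: each entry of the adjugate is a determinant whose entries are constants or
entries of A. -/
theorem contDiffOn_inv {E ι : Type*} [NormedAddCommGroup E] [NormedSpace ℝ E] [Fintype ι]
    [DecidableEq ι] {s : Set E} {A : E → Matrix ι ι ℝ}
    (hA : ∀ i j, ContDiffOn ℝ ∞ (fun x => A x i j) s) (hdet : ∀ x ∈ s, (A x).det ≠ 0) (i j : ι) :
    ContDiffOn ℝ ∞ (fun x => (A x)⁻¹ i j) s := by
  simp only [Matrix.inv_def, Ring.inverse_eq_inv', Matrix.smul_apply, smul_eq_mul,
    Matrix.adjugate_apply]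
  refine ((contDiffOn_det hA).inv hdet).mul (contDiffOn_det fun k l => ?_)
  simp only [Matrix.updateRow_apply]
  split_ifs
  · exact contDiffOn_const
  · exact hA k l

/-! ### Scores, index raising and lowering on a model -/

namespace Model

variable {H : Type*} [NormedAddCommGroup H] [InnerProductSpace ℂ H] [FiniteDimensional ℂ H]
  [CompleteSpace H] {n : ℕ} (M : Model H n)

/-- The SLD of the tangent vector with components `v` at the point with coordinates `x`, as a
continuous linear function of `v`. -/
def score (x : Fin n → ℝ) : (Fin n → ℝ) →L[ℝ] Op H :=
  Ring.inverse (omega H (M.param x)) ∘L fderiv ℝ M.param x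

variable {M} {x : Fin n → ℝ}

theorem sld_fderiv (hx : x ∈ M.dom) (v : Fin n → ℝ) :
    sld (M.param x) (fderiv ℝ M.param x v) = M.score x v :=
  sld_eq_inverse (M.param_mem x hx) (M.fderiv_param_mem hx v).1

theorem score_mem_hermitian (hx : x ∈ M.dom) (v : Fin n → ℝ) : M.score x v ∈ hermitian H := by
  rw [← sld_fderiv hx]
  exact (isSLD_sld (M.param_mem x hx) (M.fderiv_param_mem hx v).1).1

theorem reTr_mul_score (hx : x ∈ M.dom) (v : Fin n → ℝ) :
    reTr H (M.param x * M.score x v) = 0 := by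
  rw [← sld_fderiv hx]
  exact reTr_mul_sld (M.param_mem x hx) (M.fderiv_param_mem hx v)

theorem symInner_score (hx : x ∈ M.dom) (v : Fin n → ℝ) {A : Op H} (hA : A ∈ hermitian H) :
    symInner (M.param x) (M.score x v) A = reTr H (fderiv ℝ M.param x v * A) := by
  rw [← sld_fderiv hx]
  exact ((isSLD_sld (M.param_mem x hx) (M.fderiv_param_mem hx v).1).2 A hA).symm

theorem metric_eq_symInner (hx : x ∈ M.dom) (v w : Fin n → ℝ) :
    metric (M.param x) (fderiv ℝ M.param x v) (fderiv ℝ M.param x w) =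
      symInner (M.param x) (M.score x v) (M.score x w) := by
  rw [metric, sld_fderiv hx, sld_fderiv hx]

theorem linearMap_apply_eq_sum {F : Type*} [AddCommGroup F] [Module ℝ F]
    (T : (Fin n → ℝ) →ₗ[ℝ] F) (v : Fin n → ℝ) : T v = ∑ i, v i • T (Pi.single i 1) := by
  conv_lhs => rw [pi_eq_sum_univ' v, map_sum]
  exact Finset.sum_congr rfl fun i _ => map_smul T _ _

theorem metric_fderiv (hx : x ∈ M.dom) (v w : Fin n → ℝ) :
    metric (M.param x) (fderiv ℝ M.param x v) (fderiv ℝ M.param x w) =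
      v ⬝ᵥ (M.gram x).mulVec w := by
  have h1 : ∀ v w : Fin n → ℝ,
      metric (M.param x) (fderiv ℝ M.param x v) (fderiv ℝ M.param x w) =
        reTr H (fderiv ℝ M.param x v * M.score x w) := fun v w => by
    rw [metric_eq_symInner hx, symInner_score hx _ (score_mem_hermitian hx w)]
  have h2 : ∀ (f : (Fin n → ℝ) →L[ℝ] Op H) (v : Fin n → ℝ),
      f v = ∑ i, v i • f (Pi.single i 1) := fun f =>
    linearMap_apply_eq_sum (f : (Fin n → ℝ) →ₗ[ℝ] Op H)
  simp only [dotProduct, Matrix.mulVec, gram, Matrix.of_apply, push, basisField, h1]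
  rw [h2 (fderiv ℝ M.param x) v, h2 (M.score x) w, Finset.sum_mul, map_sum]
  refine Finset.sum_congr rfl fun i _ => ?_
  rw [Finset.mul_sum, map_sum, Finset.mul_sum]
  refine Finset.sum_congr rfl fun j _ => ?_
  rw [smul_mul_smul_comm, map_smul, smul_eq_mul]
  ring

/-- A kernel vector has zero length, so definiteness of the metric and injectivity of the
immersion's differential force it to vanish. -/
theorem isUnit_det_gram (hx : x ∈ M.dom) : IsUnit (M.gram x).det := by
  rw [← Matrix.isUnit_iff_isUnit_det, ← Matrix.mulVec_injective_iff_isUnit]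
  refine (injective_iff_map_eq_zero (M.gram x).mulVecLin).2 fun v hv => ?_
  have hv' : (M.gram x).mulVec v = 0 := hv
  have h1 := metric_fderiv hx v v
  rw [hv', dotProduct_zero] at h1
  have h2 := eq_zero_of_metric (M.param_mem x hx) (M.fderiv_param_mem hx v).1 h1
  exact M.immersion x hx (h2.trans (map_zero _).symm)

variable (M) in
/-- The components of the tangent vector dual to the covector `c`. -/
def raise (x c : Fin n → ℝ) : Fin n → ℝ := (M.gram x)⁻¹.mulVec c

variable (M) in
/-- The components of the covector dual to the tangent vector `v`. -/
def lower (x v : Fin n → ℝ) : Fin n → ℝ := (M.gram x).mulVec v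

theorem raise_lower (hx : x ∈ M.dom) (v : Fin n → ℝ) : M.raise x (M.lower x v) = v := by
  rw [raise, lower, Matrix.mulVec_mulVec, Matrix.nonsing_inv_mul _ (isUnit_det_gram hx),
    Matrix.one_mulVec]

theorem metric_lower (hx : x ∈ M.dom) (v w : Fin n → ℝ) :
    metric (M.param x) (fderiv ℝ M.param x v) (fderiv ℝ M.param x w) = M.lower x v ⬝ᵥ w := by
  rw [metric_comm (M.param_mem x hx) (M.fderiv_param_mem hx _).1 (M.fderiv_param_mem hx _).1,
    metric_fderiv hx, lower, dotProduct_comm]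

theorem lower_raise (hx : x ∈ M.dom) (c : Fin n → ℝ) : M.lower x (M.raise x c) = c := by
  rw [raise, lower, Matrix.mulVec_mulVec, Matrix.mul_nonsing_inv _ (isUnit_det_gram hx),
    Matrix.one_mulVec]

theorem metric_raise (hx : x ∈ M.dom) (c w : Fin n → ℝ) :
    metric (M.param x) (fderiv ℝ M.param x (M.raise x c)) (fderiv ℝ M.param x w) = c ⬝ᵥ w := by
  rw [metric_lower hx, lower_raise hx]

/-- For constant c the right side does not depend on the point. This constancy links parallelism of
the gradients to that of the coordinate fields. -/
theorem metric_raise_single (hx : x ∈ M.dom) (c : Fin n → ℝ) (j : Fin n) :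
    metric (M.param x) (fderiv ℝ M.param x (M.raise x c)) (fderiv ℝ M.param x (Pi.single j 1)) =
      c j := by
  rw [metric_raise hx, dotProduct_single, mul_one]

theorem contDiffOn_gram (i j : Fin n) : ContDiffOn ℝ ∞ (fun x => M.gram x i j) M.dom :=
  contDiffOn_metric M.contDiffOn_param M.param_mem
    (M.contDiffOn_push (X := basisField i) contDiffOn_const)
    (fun _ hx => (M.fderiv_param_mem hx _).1)
    (M.contDiffOn_push (X := basisField j) contDiffOn_const)
    fun _ hx => (M.fderiv_param_mem hx _).1

theorem contDiffOn_mulVec {A : (Fin n → ℝ) → Matrix (Fin n) (Fin n) ℝ} {c : (Fin n → ℝ) → Fin n → ℝ}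
    {s : Set (Fin n → ℝ)} (hA : ∀ i j, ContDiffOn ℝ ∞ (fun x => A x i j) s)
    (hc : ContDiffOn ℝ ∞ c s) : ContDiffOn ℝ ∞ (fun x => (A x).mulVec (c x)) s := by
  refine contDiffOn_pi.2 fun i => ?_
  simp only [Matrix.mulVec, dotProduct]
  exact ContDiffOn.sum fun j _ => (hA i j).mul (contDiffOn_pi.1 hc j)

theorem isField_raise {c : (Fin n → ℝ) → Fin n → ℝ} (hc : ContDiffOn ℝ ∞ c M.dom) :
    M.IsField fun x => M.raise x (c x) :=
  contDiffOn_mulVec (contDiffOn_inv contDiffOn_gram fun _ hx => (isUnit_det_gram hx).ne_zero) hc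

theorem contDiffOn_lower {X : (Fin n → ℝ) → Fin n → ℝ} (hX : M.IsField X) :
    ContDiffOn ℝ ∞ (fun x => M.lower x (X x)) M.dom :=
  contDiffOn_mulVec contDiffOn_gram hX

theorem contDiffOn_score {X : (Fin n → ℝ) → Fin n → ℝ} (hX : M.IsField X) :
    ContDiffOn ℝ ∞ (fun x => M.score x (X x)) M.dom :=
  (contDiffOn_sld M.contDiffOn_param M.param_mem (M.contDiffOn_push hX)
    fun _ hx => (M.fderiv_param_mem hx _).1).congr fun _ hx => (sld_fderiv hx _).symm

theorem differentiableAt_score {X : (Fin n → ℝ) → Fin n → ℝ} (hX : M.IsField X) (hx : x ∈ M.dom) :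
    DifferentiableAt ℝ (fun x => M.score x (X x)) x :=
  ((contDiffOn_score hX).contDiffAt (M.isOpen_dom.mem_nhds hx)).differentiableAt (by simp)

/-- The tangent vector is recovered from its SLD by Ω_ρ. This supplies the linear independence used
to kill the Hessian. -/
theorem score_injective (hx : x ∈ M.dom) : Function.Injective (M.score x) := by
  intro v w h
  rw [← sld_fderiv hx, ← sld_fderiv hx] at h
  refine M.immersion x hx ?_
  rw [← omega_sld (M.param_mem x hx) (M.fderiv_param_mem hx v).1, h,
    omega_sld (M.param_mem x hx) (M.fderiv_param_mem hx w).1]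

/-- The e-covariant derivative of a vector field on a model, in terms of SLDs. -/
theorem IsECovAlong.sld_eq_fderiv_score {X Y : (Fin n → ℝ) → Fin n → ℝ} {w : Op H}
    (h : M.IsECovAlong X (M.push Y) x w) (hx : x ∈ M.dom) (hY : M.IsField Y) :
    w ∈ tangent H ∧ sld (M.param x) w = fderiv ℝ (fun y => M.score y (Y y)) x (X x) +
      (M.lower x (Y x) ⬝ᵥ X x) • (1 : Op H) := by
  have hS := (differentiableAt_score hY hx).hasFDerivAt
  obtain ⟨h1, h2⟩ := h.sld_eq hx (hS.congr_of_eventuallyEq <| by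
    filter_upwards [M.isOpen_dom.mem_nhds hx] with y hy
    exact sld_fderiv hy _)
  refine ⟨h1, ?_⟩
  set S := fderiv ℝ (fun y => M.score y (Y y)) x
  have h3 := hasDerivAt_comp_line (M.hasFDerivAt_param hx) (X x)
  have h4 := hasDerivAt_comp_line hS (X x)
  -- Differentiating the identity Tr(ρ L_Y) = 0 along X identifies the mean of the derivative of L_Y
  -- as -g(X, Y).
  have h5 : HasDerivAt (fun t : ℝ =>
      reTr H (M.param (x + t • X x) * M.score (x + t • X x) (Y (x + t • X x)))) _ 0 :=
    (reTr H).hasFDerivAt.comp_hasDerivAt (0 : ℝ) (h3.mul h4)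
  have h6 : HasDerivAt (fun t : ℝ =>
      reTr H (M.param (x + t • X x) * M.score (x + t • X x) (Y (x + t • X x)))) 0 0 := by
    refine (hasDerivAt_const (0 : ℝ) (0 : ℝ)).congr_of_eventuallyEq ?_
    filter_upwards [eventually_line_mem (M.isOpen_dom.mem_nhds hx) (X x)] with t ht
    exact reTr_mul_score ht _
  have h7 := h5.unique h6
  simp only [zero_smul, add_zero, map_add] at h7
  have h8 : reTr H (fderiv ℝ M.param x (X x) * M.score x (Y x)) = M.lower x (Y x) ⬝ᵥ X x := by
    rw [← metric_lower hx, metric_comm (M.param_mem x hx) (M.fderiv_param_mem hx _).1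
      (M.fderiv_param_mem hx _).1, metric_eq_symInner hx,
      symInner_score hx _ (score_mem_hermitian hx _)]
  rw [h8] at h7
  rw [h2, eq_neg_of_add_eq_zero_right h7, neg_smul, sub_neg_eq_add]

end Model

/-! ### Estimators and observables -/

section POVM

variable {H : Type*} [NormedAddCommGroup H] [InnerProductSpace ℂ H] [FiniteDimensional ℂ H]
  [CompleteSpace H]

namespace POVM

variable (Λ : POVM H) (ρ : states H)

theorem dist_apply {B : Set ℝ} (hB : MeasurableSet B) :
    Λ.dist ρ B = ENNReal.ofReal (reTr H (ρ.1 * Λ.effect B)) :=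
  Measure.ofMeasurable_apply B hB

theorem real_dist {B : Set ℝ} (hB : MeasurableSet B) :
    (Λ.dist ρ).real B = reTr H (ρ.1 * Λ.effect B) := by
  rw [Measure.real, dist_apply Λ ρ hB, ENNReal.toReal_ofReal]
  exact tr_mul_nonneg (isPositive_of_mem_states ρ.2) (Λ.isPositive B hB)

instance : IsProbabilityMeasure (Λ.dist ρ) :=
  ⟨by rw [dist_apply Λ ρ MeasurableSet.univ, Λ.total, mul_one, reTr_apply, ρ.2.2.2]; simp⟩

/-- The integral of a simple function with respect to a POVM. -/
def simpleIntegral (s : SimpleFunc ℝ ℝ) : Op H := ∑ v ∈ s.range, v • Λ.effect (s ⁻¹' {v})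

theorem sum_effect (s : SimpleFunc ℝ ℝ) : ∑ v ∈ s.range, Λ.effect (s ⁻¹' {v}) = 1 := by
  rw [← Λ.total, ← VectorMeasure.of_biUnion_finset]
  · congr 1
    ext t
    simp
  · intro v _ w _ hvw
    exact Disjoint.preimage _ (by simpa using hvw)
  · exact fun v _ => s.measurableSet_fiber v

theorem effect_mem_hermitian (B : Set ℝ) : Λ.effect B ∈ hermitian H := by
  by_cases hB : MeasurableSet B
  · exact (Λ.isPositive B hB).isSymmetric
  -- A vector measure takes the value 0 on nonmeasurable sets, so measurability need not be assumed.
  · rw [Λ.effect.not_measurable hB]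
    exact fun x y => by simp

theorem simpleIntegral_mem_hermitian (s : SimpleFunc ℝ ℝ) :
    Λ.simpleIntegral s ∈ hermitian H := by
  rw [mem_hermitian_iff, simpleIntegral, star_sum]
  refine Finset.sum_congr rfl fun v _ => ?_
  exact mem_hermitian_iff.1 (hermitian_smul v (Λ.effect_mem_hermitian _))

theorem reTr_mul_simpleIntegral (s : SimpleFunc ℝ ℝ) :
    reTr H (ρ.1 * Λ.simpleIntegral s) = ∫ t, s t ∂(Λ.dist ρ) := by
  rw [← s.integral_eq_integral (s.integrable_of_isFiniteMeasure), SimpleFunc.integral_eq,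
    simpleIntegral, Finset.mul_sum, map_sum]
  refine Finset.sum_congr rfl fun v _ => ?_
  rw [real_dist Λ ρ (s.measurableSet_fiber v), mul_smul_comm, map_smul, smul_eq_mul, smul_eq_mul,
    mul_comm]

/-- An operator Jensen inequality. With E_v the effects and K = Σ v E_v, the positive sum Σ (v - K)
E_v (v - K) equals Σ v² E_v - K², because the effects sum to 1. -/
theorem reTr_mul_simpleIntegral_sq_le (s : SimpleFunc ℝ ℝ) :
    reTr H (ρ.1 * (Λ.simpleIntegral s * Λ.simpleIntegral s)) ≤ ∫ t, s t ^ 2 ∂(Λ.dist ρ) := by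
  set K := Λ.simpleIntegral s with hK
  have hKh := mem_hermitian_iff.1 (Λ.simpleIntegral_mem_hermitian s)
  have h1 : ∫ t, s t ^ 2 ∂(Λ.dist ρ) =
      ∑ v ∈ s.range, v ^ 2 * reTr H (ρ.1 * Λ.effect (s ⁻¹' {v})) := by
    have h2 : ∫ t, s t ^ 2 ∂(Λ.dist ρ) = ∫ t, s.map (fun v => v ^ 2) t ∂(Λ.dist ρ) := rfl
    rw [h2, ← SimpleFunc.integral_eq_integral _ (SimpleFunc.integrable_of_isFiniteMeasure _),
      SimpleFunc.map_integral _ _ s.integrable_of_isFiniteMeasure (by simp)]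
    refine Finset.sum_congr rfl fun v _ => ?_
    rw [real_dist Λ ρ (s.measurableSet_fiber v), smul_eq_mul, mul_comm]
  have h3 : ∀ v, 0 ≤ reTr H (ρ.1 * ((v • (1 : Op H) - K) * Λ.effect (s ⁻¹' {v}) *
      (v • (1 : Op H) - K))) := fun v => by
    refine tr_mul_nonneg (isPositive_of_mem_states ρ.2) ?_
    have h4 : v • (1 : Op H) - K ∈ hermitian H :=
      hermitian_sub (hermitian_smul v one_mem_hermitian) (mem_hermitian_iff.2 hKh)
    have h5 := (Λ.isPositive _ (s.measurableSet_fiber v)).conj_adjoint (v • (1 : Op H) - K)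
    rw [← ContinuousLinearMap.star_eq_adjoint, mem_hermitian_iff.1 h4] at h5
    rw [mul_assoc]
    exact h5
  have h6 : ∑ v ∈ s.range, (v • (1 : Op H) - K) * Λ.effect (s ⁻¹' {v}) * (v • (1 : Op H) - K) =
      ∑ v ∈ s.range, v ^ 2 • Λ.effect (s ⁻¹' {v}) - K * K := by
    have h7 : ∀ v : ℝ, ∀ E : Op H, (v • (1 : Op H) - K) * E * (v • (1 : Op H) - K) =
        v ^ 2 • E - (v • E) * K - K * (v • E) + K * E * K := fun v E => by
      simp only [sub_mul, mul_sub, smul_mul_assoc, mul_smul_comm, one_mul, mul_one, smul_smul,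
        smul_sub, pow_two]
      abel
    simp only [h7]
    rw [Finset.sum_add_distrib, Finset.sum_sub_distrib, Finset.sum_sub_distrib, ← Finset.sum_mul,
      ← Finset.mul_sum, ← Finset.sum_mul, ← Finset.mul_sum, Λ.sum_effect, ← simpleIntegral, ← hK,
      mul_one]
    abel
  have h8 := Finset.sum_nonneg fun v (_ : v ∈ s.range) => h3 v
  rw [← map_sum, ← Finset.mul_sum, h6, mul_sub, map_sub, Finset.mul_sum, map_sum] at h8
  simp only [mul_smul_comm, map_smul, smul_eq_mul] at h8
  rw [h1]
  linarith

/-- Strict positivity of ρ makes Tr(ρ A A*) positive on the compact unit sphere; c is a lower bound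
there, extended by homogeneity. -/
theorem _root_.QuantumModel.exists_mul_sq_le_reTr :
    ∃ c > 0, ∀ A ∈ hermitian H, c * ‖A‖ ^ 2 ≤ reTr H (ρ.1 * (A * A)) := by
  haveI : FiniteDimensional ℝ (Op H) := FiniteDimensional.complexToReal (Op H)
  haveI := FiniteDimensional.proper ℝ (Op H)
  obtain ⟨c, hc, hcx⟩ := (isCompact_sphere (0 : Op H) 1).exists_forall_le'
    (f := fun A => reTr H (ρ.1 * (A * star A))) (a := 0) (by fun_prop)
    (fun A hA => by
      by_contra hle
      have h0 := eq_zero_of_tr ρ.2 (not_lt.1 hle)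
      exact ne_zero_of_mem_unit_sphere ⟨A, hA⟩ h0)
  refine ⟨c, hc, fun A hA => ?_⟩
  by_cases h0 : A = 0
  · simp [h0, -reTr_apply]
  have hpos : 0 < ‖A‖ := norm_pos_iff.2 h0
  have h1 := hcx (‖A‖⁻¹ • A) (by simp [norm_smul, hpos.ne'])
  rw [mem_hermitian_iff.1 (hermitian_smul ‖A‖⁻¹ hA), smul_mul_smul_comm, mul_smul_comm, map_smul,
    smul_eq_mul] at h1
  have h2 : ‖A‖⁻¹ * ‖A‖⁻¹ * reTr H (ρ.1 * (A * A)) = reTr H (ρ.1 * (A * A)) / ‖A‖ ^ 2 := by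
    field_simp
  rw [h2, le_div_iff₀ (by positivity)] at h1
  exact h1

/-- An estimator with finite second moment in some state has a mean operator. -/
theorem exists_mean_operator (h : MemLp (fun t : ℝ => t) 2 (Λ.dist ρ)) :
    ∃ A ∈ hermitian H,
      (∀ σ, Integrable (fun t : ℝ => t) (Λ.dist σ) → Λ.mean σ = reTr H (σ.1 * A)) ∧
      ∀ σ, MemLp (fun t : ℝ => t) 2 (Λ.dist σ) →
        reTr H (σ.1 * (A * A)) ≤ ∫ t, t ^ 2 ∂(Λ.dist σ) := by
  haveI : FiniteDimensional ℝ (Op H) := FiniteDimensional.complexToReal (Op H)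
  haveI := FiniteDimensional.proper ℝ (Op H)
  -- Approximating from the base value 0 gives |s_k(t)| ≤ 2|t|, a domination valid for the
  -- distribution in every state at once.
  let s : ℕ → SimpleFunc ℝ ℝ := SimpleFunc.approxOn id measurable_id univ 0 trivial
  have hs_le : ∀ k t, |s k t| ≤ 2 * |t| := fun k t => by
    have := SimpleFunc.norm_approxOn_zero_le measurable_id (s := univ) trivial t k
    simp only [id, Real.norm_eq_abs] at this
    linarith
  have hs_lim : ∀ t, Tendsto (fun k => s k t) atTop (𝓝 t) := fun t =>
    SimpleFunc.tendsto_approxOn measurable_id (mem_univ 0) (by simp)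
  have hsq_le : ∀ k t, s k t ^ 2 ≤ 4 * t ^ 2 := fun k t => by
    have h1 := pow_le_pow_left₀ (abs_nonneg _) (hs_le k t) 2
    rw [mul_pow, sq_abs, sq_abs] at h1
    linarith
  have hsqi : ∀ σ, MemLp (fun t : ℝ => t) 2 (Λ.dist σ) →
      Integrable (fun t : ℝ => t ^ 2) (Λ.dist σ) := fun σ hσ =>
    (memLp_two_iff_integrable_sq hσ.1).1 hσ
  have hlim1 : ∀ σ, Integrable (fun t : ℝ => t) (Λ.dist σ) →
      Tendsto (fun k => ∫ t, s k t ∂(Λ.dist σ)) atTop (𝓝 (Λ.mean σ)) := fun σ hσ =>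
    tendsto_integral_of_dominated_convergence (fun t => 2 * |t|)
      (fun k => (s k).measurable.aestronglyMeasurable) (hσ.abs.const_mul 2)
      (fun k => ae_of_all _ fun t => hs_le k t) (ae_of_all _ hs_lim)
  have hlim2 : ∀ σ, MemLp (fun t : ℝ => t) 2 (Λ.dist σ) →
      Tendsto (fun k => ∫ t, s k t ^ 2 ∂(Λ.dist σ)) atTop (𝓝 (∫ t, t ^ 2 ∂(Λ.dist σ))) :=
    fun σ hσ => tendsto_integral_of_dominated_convergence (fun t => 4 * t ^ 2)
      (fun k => ((s k).measurable.pow_const 2).aestronglyMeasurable) ((hsqi σ hσ).const_mul 4)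
      (fun k => ae_of_all _ fun t => by
        rw [Real.norm_eq_abs, abs_of_nonneg (sq_nonneg _)]; exact hsq_le k t)
      (ae_of_all _ fun t => (hs_lim t).pow 2)
  obtain ⟨c, hc, hcA⟩ := exists_mul_sq_le_reTr ρ
  obtain ⟨R, hR⟩ : ∃ R, ∀ k, ∫ t, s k t ^ 2 ∂(Λ.dist ρ) ≤ R := by
    obtain ⟨R, hR⟩ := (hlim2 ρ h).bddAbove_range
    exact ⟨R, fun k => hR ⟨k, rfl⟩⟩
  -- The second moment in the single full-rank state ρ bounds the norms of the approximating
  -- operators. A subsequential limit A exists by compactness, and it serves all states because the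
  -- operators do not depend on the state.
  have hbound : ∀ k, Λ.simpleIntegral (s k) ∈ Metric.closedBall (0 : Op H) √(R / c) := fun k => by
    rw [mem_closedBall_zero_iff]
    refine Real.le_sqrt_of_sq_le ?_
    rw [le_div_iff₀ hc, mul_comm]
    exact (hcA _ (Λ.simpleIntegral_mem_hermitian _)).trans
      ((Λ.reTr_mul_simpleIntegral_sq_le ρ _).trans (hR k))
  obtain ⟨A, -, φ, hφ, hA⟩ := tendsto_subseq_of_bounded Metric.isBounded_closedBall hbound
  refine ⟨A, isClosed_hermitian.mem_of_tendsto hA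
    (Eventually.of_forall fun k => Λ.simpleIntegral_mem_hermitian _), fun σ hσ => ?_, fun σ hσ => ?_⟩
  · refine tendsto_nhds_unique ((hlim1 σ hσ).comp hφ.tendsto_atTop) ?_
    refine (((reTr H).continuous.tendsto _).comp (hA.const_mul σ.1)).congr fun k => ?_
    exact Λ.reTr_mul_simpleIntegral σ _
  · refine le_of_tendsto_of_tendsto' (((reTr H).continuous.tendsto _).comp
      ((hA.mul hA).const_mul σ.1)) ((hlim2 σ hσ).comp hφ.tendsto_atTop) fun k => ?_
    exact Λ.reTr_mul_simpleIntegral_sq_le σ _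

/-- The spectral measure of an observable, as an estimator. -/
theorem _root_.QuantumModel.exists_spectral_povm {A : Op H} (hA : A ∈ hermitian H) :
    ∃ Λ : POVM H, ∀ σ : states H, Integrable (fun t : ℝ => t) (Λ.dist σ) ∧
      Λ.mean σ = reTr H (σ.1 * A) ∧
      ∀ c : ℝ, Λ.mse σ c = ENNReal.ofReal
        (reTr H (σ.1 * ((A - c • (1 : Op H)) * (A - c • (1 : Op H))))) := by
  have hs : (A : H →ₗ[ℂ] H).IsSymmetric := hA
  let b := hs.eigenvectorBasis rfl
  let l := hs.eigenvalues rfl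
  let P : Fin (Module.finrank ℂ H) → Op H := fun i => InnerProductSpace.rankOne ℂ (b i) (b i)
  have hPpos : ∀ i, (P i).IsPositive := fun i => InnerProductSpace.isPositive_rankOne_self (b i)
  have hsum : ∑ i, P i = 1 := b.sum_rankOne_eq_id
  have hAb : ∀ i, A (b i) = ((l i : ℝ) : ℂ) • b i := fun i => hs.apply_eigenvectorBasis rfl i
  have hAP : ∀ i, A * P i = l i • P i := fun i => by
    ext x
    change A (inner ℂ (b i) x • b i) = ((l i : ℝ) : ℂ) • (inner ℂ (b i) x • b i)
    rw [map_smul, hAb, smul_comm]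
  have hA1 : A = ∑ i, l i • P i := by
    rw [← mul_one A, ← hsum, Finset.mul_sum]
    exact Finset.sum_congr rfl fun i _ => hAP i
  have hAc : ∀ c : ℝ, (A - c • (1 : Op H)) * (A - c • (1 : Op H)) =
      ∑ i, (l i - c) ^ 2 • P i := fun c => by
    have h1 : ∀ i, (A - c • (1 : Op H)) * P i = (l i - c) • P i := fun i => by
      rw [sub_mul, hAP, smul_mul_assoc, one_mul, sub_smul]
    refine (mul_one _).symm.trans ?_
    conv_lhs => rw [← hsum, Finset.mul_sum]
    refine Finset.sum_congr rfl fun i _ => ?_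
    -- Inserting Σ P_i for 1 also replaced the identities inside `A - c • 1`; `hsum` restores them.
    rw [hsum, mul_assoc, h1, mul_smul_comm, h1, smul_smul, pow_two]
  classical
  have heff : ∀ B, MeasurableSet B → (∑ i, VectorMeasure.dirac (l i) (P i)) B =
      ∑ i, if l i ∈ B then P i else 0 := fun B hB => by
    rw [FunLike.coe_sum, Finset.sum_apply]
    refine Finset.sum_congr rfl fun i _ => ?_
    split_ifs with h
    · exact VectorMeasure.dirac_apply_of_mem hB h
    · exact VectorMeasure.dirac_apply_of_notMem h
  -- Eigenvalues are listed with multiplicity; point masses at equal eigenvalues add up to the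
  -- spectral projection.
  let Λ : POVM H :=
    { effect := ∑ i, VectorMeasure.dirac (l i) (P i)
      isPositive := fun B hB => by
        rw [heff B hB]
        refine Finset.sum_induction _ ContinuousLinearMap.IsPositive (fun _ _ => .add)
          ContinuousLinearMap.isPositive_zero fun i _ => ?_
        split_ifs
        · exact hPpos i
        · exact ContinuousLinearMap.isPositive_zero
      total := by rw [heff _ MeasurableSet.univ]; simpa using hsum }
  refine ⟨Λ, fun σ => ?_⟩
  have hw : ∀ i, 0 ≤ reTr H (σ.1 * P i) := fun i =>
    tr_mul_nonneg (isPositive_of_mem_states σ.2) (hPpos i)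
  have hdist : Λ.dist σ = ∑ i, ENNReal.ofReal (reTr H (σ.1 * P i)) • Measure.dirac (l i) := by
    refine Measure.ext fun B hB => ?_
    rw [dist_apply Λ σ hB, Measure.finsetSum_apply]
    change ENNReal.ofReal (reTr H (σ.1 * (∑ i, VectorMeasure.dirac (l i) (P i)) B)) = _
    rw [heff B hB, Finset.mul_sum, map_sum, ENNReal.ofReal_sum_of_nonneg]
    · refine Finset.sum_congr rfl fun i _ => ?_
      rw [Measure.smul_apply, Measure.dirac_apply' _ hB, smul_eq_mul]
      by_cases h : l i ∈ B <;> simp [h, -reTr_apply]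
    · intro i _
      split_ifs
      · exact hw i
      · simp [-reTr_apply]
  have hint : ∀ i ∈ Finset.univ, Integrable (fun t : ℝ => t)
      (ENNReal.ofReal (reTr H (σ.1 * P i)) • Measure.dirac (l i)) := fun i _ =>
    (integrable_dirac (by simp)).smul_measure ENNReal.ofReal_ne_top
  refine ⟨?_, ?_, fun c => ?_⟩
  · rw [hdist]
    exact integrable_finsetSum_measure.2 hint
  · rw [mean, hdist, integral_finsetSum_measure hint]
    conv_rhs => rw [hA1]
    rw [Finset.mul_sum, map_sum]
    refine Finset.sum_congr rfl fun i _ => ?_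
    rw [integral_smul_measure, integral_dirac, ENNReal.toReal_ofReal (hw i), mul_smul_comm,
      map_smul, smul_eq_mul, smul_eq_mul, mul_comm]
  · rw [mse, hdist, lintegral_finsetSum_measure, hAc, Finset.mul_sum, map_sum,
      ENNReal.ofReal_sum_of_nonneg]
    · refine Finset.sum_congr rfl fun i _ => ?_
      rw [lintegral_smul_measure, lintegral_dirac, mul_smul_comm, map_smul, smul_eq_mul,
        smul_eq_mul, ENNReal.ofReal_mul (sq_nonneg _), mul_comm]
    · intro i _
      rw [mul_smul_comm, map_smul]
      exact smul_nonneg (sq_nonneg _) (hw i)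

end POVM

end POVM

/-! ### Functions admitting an efficient estimator -/

namespace Model

variable {H : Type*} [NormedAddCommGroup H] [InnerProductSpace ℂ H] [FiniteDimensional ℂ H]
  [CompleteSpace H] {n : ℕ} {M : Model H n} {x : Fin n → ℝ} {f : M.carrier → ℝ}

theorem rep_apply (hx : x ∈ M.dom) : M.rep f x = f ⟨M.param x, mem_image_of_mem _ hx⟩ :=
  dif_pos hx

theorem coord_param (hx : x ∈ M.dom) : M.coord ⟨M.param x, mem_image_of_mem _ hx⟩ = x :=
  congrArg Subtype.val ((Equiv.Set.imageOfInjOn M.param M.dom M.injOn_param).symm_apply_apply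
    ⟨x, hx⟩)

theorem coord_mem (p : M.carrier) : M.coord p ∈ M.dom :=
  ((Equiv.Set.imageOfInjOn M.param M.dom M.injOn_param).symm p).2

theorem param_coord (p : M.carrier) : M.param (M.coord p) = p.1 :=
  congrArg Subtype.val
    ((Equiv.Set.imageOfInjOn M.param M.dom M.injOn_param).apply_symm_apply p)

theorem rep_coord (p : M.carrier) : M.rep f (M.coord p) = f p := by
  rw [rep_apply (coord_mem p)]
  congr 1
  exact Subtype.ext (param_coord p)

variable (M) in
/-- The components `∂_i f` of the differential of a function. -/
def diff (f : M.carrier → ℝ) (x : Fin n → ℝ) : Fin n → ℝ := fun i => M.partialDeriv i f x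

theorem fderiv_rep (v : Fin n → ℝ) : fderiv ℝ (M.rep f) x v = M.diff f x ⬝ᵥ v := by
  refine (linearMap_apply_eq_sum (fderiv ℝ (M.rep f) x : (Fin n → ℝ) →ₗ[ℝ] ℝ) v).trans ?_
  exact Finset.sum_congr rfl fun i _ => mul_comm _ _

theorem normSqD_eq : M.normSqD f x = M.diff f x ⬝ᵥ M.raise x (M.diff f x) := by
  simp only [normSqD, dotProduct, raise, Matrix.mulVec, Finset.mul_sum, diff]
  exact Finset.sum_congr rfl fun i _ => Finset.sum_congr rfl fun j _ => by ring

theorem symInner_eq_reTr (ρ A B : Op H) : symInner ρ A B = reTr H (ρ * (A * B)) := by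
  rw [← mul_assoc]; rfl

theorem normSqD_eq_reTr (hx : x ∈ M.dom) : M.normSqD f x = reTr H (M.param x *
    (M.score x (M.raise x (M.diff f x)) * M.score x (M.raise x (M.diff f x)))) := by
  rw [normSqD_eq, ← metric_raise hx, metric_eq_symInner hx, symInner_eq_reTr]

theorem reTr_param (hx : x ∈ M.dom) : reTr H (M.param x) = 1 := by
  rw [reTr_apply, (M.param_mem x hx).2.2, Complex.one_re]

/-- The equality case of the SLD Cramér-Rao inequality. -/
theorem eq_score_of_reTr_sq_le (hx : x ∈ M.dom) {K : Op H} (hK : K ∈ hermitian H)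
    (hd : ∀ i, reTr H (fderiv ℝ M.param x (Pi.single i 1) * K) = M.partialDeriv i f x)
    (hv : reTr H (M.param x * (K * K)) ≤ M.normSqD f x) :
    K = M.score x (M.raise x (M.diff f x)) := by
  set G := M.score x (M.raise x (M.diff f x)) with hG
  have hGh : G ∈ hermitian H := score_mem_hermitian hx _
  have h1 : reTr H (M.param x * (G * K)) = M.normSqD f x := by
    rw [← symInner_eq_reTr, symInner_score hx _ hK, normSqD_eq, dotProduct_comm]
    let T : (Fin n → ℝ) →ₗ[ℝ] ℝ :=
      (((reTr H).comp ((ContinuousLinearMap.mul ℝ (Op H)).flip K)).comp (fderiv ℝ M.param x) :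
        (Fin n → ℝ) →L[ℝ] ℝ)
    refine (linearMap_apply_eq_sum T _).trans ?_
    exact Finset.sum_congr rfl fun i _ => congrArg _ (hd i)
  have h2 : reTr H (M.param x * (K * G)) = M.normSqD f x := by
    rw [← h1, ← symInner_eq_reTr, ← symInner_eq_reTr,
      symInner_comm (M.param_mem x hx).1 hK hGh]
  -- Both cross terms equal ‖df‖², which is also the squared length of G, so ‖K - G‖² = ‖K‖² - ‖df‖²
  -- ≤ 0.
  refine sub_eq_zero.1 (eq_zero_of_tr (M.param_mem x hx) ?_)
  rw [mem_hermitian_iff.1 (hermitian_sub hK hGh)]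
  have h3 : M.param x * ((K - G) * (K - G)) = M.param x * (K * K) - M.param x * (K * G) -
      M.param x * (G * K) + M.param x * (G * G) := by noncomm_ring
  change reTr H _ ≤ 0
  rw [h3, map_add, map_sub, map_sub, h1, h2, hG, ← normSqD_eq_reTr hx]
  linarith

/-- The mean operator A, built at one base state, works on all of M. Centered at f, it inherits the
mean and its derivative from Λ, and its variance cannot exceed that of Λ, so it attains equality in
the Cramér-Rao bound. -/
theorem IsEfficient.exists_observable {Λ : POVM H} (h : M.IsEfficient Λ f) :
    ∃ A ∈ hermitian H, ∀ x ∈ M.dom,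
      A - M.rep f x • (1 : Op H) = M.score x (M.raise x (M.diff f x)) := by
  have hmem : ∀ p : M.carrier, MemLp (fun t : ℝ => t) 2 (Λ.dist (M.toState p)) := fun p => by
    have h1 : MemLp (fun t : ℝ => t - f p) 2 (Λ.dist (M.toState p)) := by
      refine (memLp_two_iff_integrable_sq (by fun_prop)).2 ⟨by fun_prop, ?_⟩
      rw [hasFiniteIntegral_iff_ofReal (ae_of_all _ fun t => sq_nonneg _)]
      exact (h p).2.trans_lt ENNReal.ofReal_lt_top
    convert h1.add (memLp_const (f p)) using 1
    ext t
    simp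
  obtain ⟨x₀, hx₀⟩ := M.isConnected_dom.nonempty
  obtain ⟨A, hA, hmean, hsq⟩ := Λ.exists_mean_operator _
    (hmem ⟨M.param x₀, mem_image_of_mem _ hx₀⟩)
  refine ⟨A, hA, fun x hx => ?_⟩
  set p : M.carrier := ⟨M.param x, mem_image_of_mem _ hx⟩ with hp
  obtain ⟨⟨hint, hm, hdm⟩, hmse⟩ := h p
  rw [coord_param hx] at hdm hmse
  rw [rep_apply hx]
  have hAf : reTr H (M.param x * A) = f p := by rw [← hm, hmean _ (hint p)]; rfl
  refine eq_score_of_reTr_sq_le hx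
    (hermitian_sub hA (hermitian_smul _ one_mem_hermitian)) (fun i => ?_) ?_
  · rw [mul_sub, map_sub, mul_smul_comm, mul_one, map_smul, reTr_apply (fderiv _ _ _ _),
      (M.fderiv_param_mem hx _).2, Complex.zero_re, smul_zero, sub_zero, ← hdm i, partialDeriv]
    have h1 : HasFDerivAt (fun y => reTr H (M.param y * A))
        ((reTr H).comp (((ContinuousLinearMap.mul ℝ (Op H)).flip A).comp (fderiv ℝ M.param x)))
        x :=
      ((reTr H).comp ((ContinuousLinearMap.mul ℝ (Op H)).flip A)).hasFDerivAt.comp x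
        (M.hasFDerivAt_param hx)
    rw [(h1.congr_of_eventuallyEq ?_).fderiv]
    · rfl
    · filter_upwards [M.isOpen_dom.mem_nhds hx] with y hy
      rw [rep_apply hy, hmean _ (hint _)]
      rfl
  -- Nonnegativity is needed to pass from equality of truncated values in `ENNReal` to equality of
  -- reals.
  · have hn : 0 ≤ M.normSqD f x := by
      rw [normSqD_eq_reTr hx, ← symInner_eq_reTr]
      have h2 := tr_mul_nonneg (isPositive_of_mem_states (M.param_mem x hx))
        (ContinuousLinearMap.isPositive_adjoint_comp_self (M.score x (M.raise x (M.diff f x))))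
      rw [← ContinuousLinearMap.star_eq_adjoint,
        mem_hermitian_iff.1 (score_mem_hermitian hx _)] at h2
      rw [symInner_eq_reTr]
      exact h2
    have hsqi : Integrable (fun t : ℝ => t ^ 2) (Λ.dist (M.toState p)) :=
      (memLp_two_iff_integrable_sq (hmem p).1).1 (hmem p)
    have h3 : ∫ t, (t - f p) ^ 2 ∂(Λ.dist (M.toState p)) = M.normSqD f x := by
      have h4 : Integrable (fun t : ℝ => (t - f p) ^ 2) (Λ.dist (M.toState p)) :=
        (memLp_two_iff_integrable_sq (by fun_prop)).1 ((hmem p).sub (memLp_const (f p)))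
      rw [POVM.mse, ← ofReal_integral_eq_lintegral_ofReal h4 (ae_of_all _ fun t => sq_nonneg _)]
        at hmse
      rwa [ENNReal.ofReal_eq_ofReal_iff (integral_nonneg fun t => sq_nonneg _) hn] at hmse
    have h5 : ∫ t, (t - f p) ^ 2 ∂(Λ.dist (M.toState p)) =
        ∫ t, t ^ 2 ∂(Λ.dist (M.toState p)) - f p ^ 2 := by
      have h6 : ∀ t : ℝ, (t - f p) ^ 2 = t ^ 2 - 2 * f p * t + f p ^ 2 := fun t => by ring
      simp only [h6]
      rw [integral_add (f := fun t : ℝ => t ^ 2 - 2 * f p * t) (hsqi.sub ((hint p).const_mul _))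
          (integrable_const _),
        integral_sub hsqi ((hint p).const_mul _), integral_const_mul]
      have h7 : ∫ t, t ∂(Λ.dist (M.toState p)) = f p := hm
      rw [h7]
      simp
      ring
    have h8 := hsq _ (hmem p)
    have h9 : M.param x * ((A - f p • (1 : Op H)) * (A - f p • (1 : Op H))) =
        M.param x * (A * A) - (2 * f p) • (M.param x * A) + (f p ^ 2) • M.param x := by
      simp only [sub_mul, mul_sub, smul_mul_assoc, mul_smul_comm, one_mul, mul_one]
      module
    rw [h9, map_add, map_sub, map_smul, map_smul, hAf, reTr_param hx, ← h3, h5]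
    change reTr H (M.param x * (A * A)) ≤ _ at h8
    simp only [smul_eq_mul]
    linarith

/-- Scores have mean zero, so A has mean f throughout M and its spectral measure is unbiased; its
variance is the squared length of the score of grad f. -/
theorem exists_isEfficient {A : Op H} (hA : A ∈ hermitian H)
    (h : ∀ x ∈ M.dom, A - M.rep f x • (1 : Op H) = M.score x (M.raise x (M.diff f x))) :
    ∃ Λ : POVM H, M.IsEfficient Λ f := by
  obtain ⟨Λ, hΛ⟩ := exists_spectral_povm hA
  have hmean : (fun q => Λ.mean (M.toState q)) = f := funext fun q => by
    have h1 : M.toState q = ⟨M.param (M.coord q), M.param_mem _ (coord_mem q)⟩ :=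
      Subtype.ext (param_coord q).symm
    rw [(hΛ _).2.1, h1, sub_eq_iff_eq_add.1 (h _ (coord_mem q)), mul_add, map_add,
      reTr_mul_score (coord_mem q), mul_smul_comm, mul_one, map_smul, reTr_param (coord_mem q),
      rep_coord]
    simp
  refine ⟨Λ, fun p => ⟨⟨fun q => (hΛ _).1, congrFun hmean p, fun i => by rw [hmean]⟩, ?_⟩⟩
  rw [(hΛ _).2.2, ← rep_coord (f := f) p, h _ (coord_mem p), normSqD_eq_reTr (coord_mem p), param_coord]
  rfl

theorem mem_effFunctions_iff : f ∈ M.effFunctions ↔ M.IsSmooth f ∧ ∃ A ∈ hermitian H,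
    ∀ x ∈ M.dom, A - M.rep f x • (1 : Op H) = M.score x (M.raise x (M.diff f x)) :=
  and_congr_right fun _ => ⟨fun ⟨_, h⟩ => h.exists_observable,
    fun ⟨_, hA, h⟩ => exists_isEfficient hA h⟩

end Model

/-! ### Models with efficiently estimable coordinates -/

namespace Model

variable {H : Type*} [NormedAddCommGroup H] [InnerProductSpace ℂ H] [FiniteDimensional ℂ H]
  [CompleteSpace H] {n : ℕ} {M : Model H n} {x : Fin n → ℝ} {f : M.carrier → ℝ}

/-! ### Affine functions of the coordinates -/

section Affine

variable {c : ℝ} {u : Fin n → ℝ}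

theorem rep_affine (hx : x ∈ M.dom) :
    M.rep (fun p => c + ∑ i, u i * M.coord p i) x = c + u ⬝ᵥ x := by
  rw [rep_apply hx, coord_param hx]
  rfl

theorem hasFDerivAt_dotProduct (u x : Fin n → ℝ) :
    HasFDerivAt (fun y => u ⬝ᵥ y)
      (∑ i, u i • ContinuousLinearMap.proj (R := ℝ) (φ := fun _ : Fin n => ℝ) i) x := by
  simp only [dotProduct]
  exact HasFDerivAt.fun_sum fun i _ => (hasFDerivAt_apply i x).const_mul (u i)

theorem diff_affine (hx : x ∈ M.dom) : M.diff (fun p => c + ∑ i, u i * M.coord p i) x = u := by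
  funext i
  rw [diff, partialDeriv, (((hasFDerivAt_dotProduct u x).const_add c).congr_of_eventuallyEq
    (by filter_upwards [M.isOpen_dom.mem_nhds hx] with y hy using rep_affine hy)).fderiv]
  simp [Pi.single_apply]

theorem isSmooth_affine : M.IsSmooth fun p => c + ∑ i, u i * M.coord p i := by
  refine ContDiffOn.congr (f := fun x => c + u ⬝ᵥ x) (ContDiff.contDiffOn ?_)
    fun x hx => rep_affine hx
  simp only [dotProduct]
  fun_prop

theorem coord_eq_affine (i : Fin n) : (fun p => M.coord p i) =
    fun p => (0 : ℝ) + ∑ j, (Pi.single i 1 : Fin n → ℝ) j * M.coord p j := by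
  simp [Pi.single_apply]

end Affine

variable (M) in
/-- The observables `A i` are efficient estimators for the coordinates. -/
def IsEfficientFrame (A : Fin n → Op H) : Prop :=
  ∀ i, A i ∈ hermitian H ∧
    ∀ x ∈ M.dom, A i - x i • (1 : Op H) = M.score x (M.raise x (Pi.single i 1))

theorem coord_mem_effFunctions_iff :
    (∀ i : Fin n, (fun p => M.coord p i) ∈ M.effFunctions) ↔ ∃ A, M.IsEfficientFrame A := by
  have h1 : ∀ i : Fin n, (fun p => M.coord p i) ∈ M.effFunctions ↔ ∃ A ∈ hermitian H,
      ∀ x ∈ M.dom, A - x i • (1 : Op H) = M.score x (M.raise x (Pi.single i 1)) := fun i => by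
    rw [coord_eq_affine, mem_effFunctions_iff, and_iff_right isSmooth_affine]
    refine exists_congr fun A => and_congr_right fun _ => forall₂_congr fun x hx => ?_
    rw [rep_affine hx, diff_affine hx]
    simp
  simp only [h1]
  exact ⟨fun h => by choose A hA using h; exact ⟨A, hA⟩, fun ⟨A, hA⟩ i => ⟨A i, hA i⟩⟩

theorem raise_zero : M.raise x 0 = 0 := Matrix.mulVec_zero _

theorem raise_injective (hx : x ∈ M.dom) {c : Fin n → ℝ} (h : M.raise x c = 0) : c = 0 := by
  rw [← lower_raise hx c, h, lower, Matrix.mulVec_zero]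

/-! ### Consequences of an efficient frame -/

namespace IsEfficientFrame

variable {A : Fin n → Op H}

theorem score_raise (hA : M.IsEfficientFrame A) (hx : x ∈ M.dom) (c : Fin n → ℝ) :
    M.score x (M.raise x c) = ∑ i, c i • (A i - x i • (1 : Op H)) := by
  refine (linearMap_apply_eq_sum
    ((M.score x : (Fin n → ℝ) →ₗ[ℝ] Op H) ∘ₗ (M.gram x)⁻¹.mulVecLin) c).trans ?_
  exact Finset.sum_congr rfl fun i _ => congrArg _ ((hA i).2 x hx).symm

/-- The A i are constant operators, so the product rule applied to Σ c_i (A i - y_i) differentiates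
only c and the scalar shifts y_i. -/
theorem fderiv_score_raise (hA : M.IsEfficientFrame A) (hx : x ∈ M.dom)
    {c : (Fin n → ℝ) → Fin n → ℝ} (hc : DifferentiableAt ℝ c x) (v : Fin n → ℝ) :
    fderiv ℝ (fun y => M.score y (M.raise y (c y))) x v =
      M.score x (M.raise x (fderiv ℝ c x v)) - (c x ⬝ᵥ v) • (1 : Op H) := by
  have h1 : ∀ i, HasFDerivAt (fun y : Fin n → ℝ => A i - y i • (1 : Op H))
      (-((ContinuousLinearMap.proj (R := ℝ) (φ := fun _ : Fin n => ℝ) i).smulRight (1 : Op H))) x :=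
    fun i => ((hasFDerivAt_apply i x).smul_const (1 : Op H)).const_sub (A i)
  have h2 := HasFDerivAt.fun_sum (u := Finset.univ) fun i (_ : i ∈ Finset.univ) =>
    ((hasFDerivAt_pi'.1 hc.hasFDerivAt) i).smul (h1 i)
  rw [(h2.congr_of_eventuallyEq (by
    filter_upwards [M.isOpen_dom.mem_nhds hx] with y hy using hA.score_raise hy (c y))).fderiv,
    hA.score_raise hx, dotProduct, Finset.sum_smul, ← Finset.sum_sub_distrib]
  simp only [sum_apply]
  refine Finset.sum_congr rfl fun i _ => ?_
  simp [mul_smul]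
  abel

/-- The e-covariant derivative in terms of the frame dual to the coordinates. -/
theorem eq_push_of_isECovAlong (hA : M.IsEfficientFrame A) (hx : x ∈ M.dom)
    {X Y : (Fin n → ℝ) → Fin n → ℝ} (hY : M.IsField Y) {w : Op H}
    (h : M.IsECovAlong X (M.push Y) x w) :
    w = fderiv ℝ M.param x (M.raise x (fderiv ℝ (fun y => M.lower y (Y y)) x (X x))) := by
  obtain ⟨hw, h1⟩ := h.sld_eq_fderiv_score hx hY
  have h2 : fderiv ℝ (fun y => M.score y (Y y)) x =
      fderiv ℝ (fun y => M.score y (M.raise y (M.lower y (Y y)))) x := by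
    refine Filter.EventuallyEq.fderiv_eq ?_
    filter_upwards [M.isOpen_dom.mem_nhds hx] with y hy
    rw [raise_lower hy]
  -- The scalar from the shifts cancels exactly against the centering term g(X, Y). Thus ∇^(e) just
  -- differentiates the covariant components of Y.
  rw [h2, hA.fderiv_score_raise hx (((contDiffOn_lower hY).contDiffAt
    (M.isOpen_dom.mem_nhds hx)).differentiableAt (by simp)), sub_add_cancel, ← sld_fderiv hx] at h1
  rw [← omega_sld (M.param_mem x hx) hw.1, h1,
    omega_sld (M.param_mem x hx) (M.fderiv_param_mem hx _).1]

theorem eAutoparallel (hA : M.IsEfficientFrame A) : M.EAutoparallel := by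
  intro X Y hX hY
  refine ⟨fun x => M.raise x (fderiv ℝ (fun y => M.lower y (Y y)) x (X x)),
    isField_raise (((contDiffOn_lower hY).fderiv_of_isOpen M.isOpen_dom (by simp)).clm_apply hX),
    fun x hx => ?_⟩
  -- The formula only identifies a given covariant derivative; its existence requires a local
  -- extension of Y.
  obtain ⟨w, hw⟩ := M.exists_isECovAlong X hY hx
  rw [hA.eq_push_of_isECovAlong hx hY hw] at hw
  exact hw

/-- Since g(Y, ∂_j) is the j-th covariant component of Y, its derivative along ∂_i is already
g(∇^(e)_{∂_i} Y, ∂_j), leaving nothing for the dual term. -/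
theorem isMAffine (hA : M.IsEfficientFrame A) : M.IsMAffine := by
  refine fun i j => ⟨contDiffOn_const, fun Y hY x hx w hw => ?_⟩
  rw [hA.eq_push_of_isECovAlong hx hY hw]
  simp only [push, basisField, metric_raise_single hx]
  have h1 : metric (M.param x) (fderiv ℝ M.param x (Y x))
      (fderiv ℝ M.param x ((0 : (Fin n → ℝ) → Fin n → ℝ) x)) = 0 := by
    rw [metric_lower hx, Pi.zero_apply, dotProduct_zero]
  rw [h1, add_zero]
  have hl : HasFDerivAt (fun y => M.lower y (Y y)) _ x :=
    (((contDiffOn_lower hY).contDiffAt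
      (M.isOpen_dom.mem_nhds hx)).differentiableAt (by simp)).hasFDerivAt
  rw [((hasFDerivAt_pi'.1 hl j).congr_of_eventuallyEq (by
    filter_upwards [M.isOpen_dom.mem_nhds hx] with y hy
    rw [metric_lower hy, dotProduct_single, mul_one])).fderiv]
  rfl

theorem affine_mem_effFunctions (hA : M.IsEfficientFrame A) (c : ℝ) (u : Fin n → ℝ) :
    (fun p => c + ∑ i, u i * M.coord p i) ∈ M.effFunctions := by
  refine mem_effFunctions_iff.2 ⟨isSmooth_affine, c • (1 : Op H) + ∑ i, u i • A i, ?_,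
    fun x hx => ?_⟩
  · rw [mem_hermitian_iff, star_add, star_sum,
      mem_hermitian_iff.1 (hermitian_smul c one_mem_hermitian)]
    congr 1
    exact Finset.sum_congr rfl fun i _ => mem_hermitian_iff.1 (hermitian_smul _ (hA i).1)
  · rw [rep_affine hx, diff_affine hx, hA.score_raise hx]
    simp only [smul_sub, smul_smul, Finset.sum_sub_distrib, ← Finset.sum_smul]
    rw [add_smul, dotProduct]
    abel

theorem exists_affine (hA : M.IsEfficientFrame A) (hf : f ∈ M.effFunctions) :
    ∃ (c : ℝ) (u : Fin n → ℝ), f = fun p => c + ∑ i, u i * M.coord p i := by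
  obtain ⟨hs, B, -, hB⟩ := mem_effFunctions_iff.1 hf
  have hfd : DifferentiableOn ℝ (M.rep f) M.dom := hs.differentiableOn (by simp)
  have hd : ContDiffOn ℝ ∞ (M.diff f) M.dom := contDiffOn_pi.2 fun i =>
    (hs.fderiv_of_isOpen M.isOpen_dom (by simp)).clm_apply contDiffOn_const
  have hdd : DifferentiableOn ℝ (M.diff f) M.dom := hd.differentiableOn (by simp)
  -- Both sides of B - f = L_{grad f} are differentiated: the scalar terms -df(v) agree, so the
  -- score built from the Hessian vanishes.
  have hd0 : M.dom.EqOn (fderiv ℝ (M.diff f)) 0 := fun x hx => by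
    ext1 v
    have hnx := M.isOpen_dom.mem_nhds hx
    have h1 := hA.fderiv_score_raise hx (hdd.differentiableAt hnx) v
    have h2 : HasFDerivAt (fun y => B - M.rep f y • (1 : Op H)) _ x :=
      ((hfd.differentiableAt hnx).hasFDerivAt.smul_const (1 : Op H)).const_sub B
    have h3 : fderiv ℝ (fun y => M.score y (M.raise y (M.diff f y))) x =
        fderiv ℝ (fun y => B - M.rep f y • (1 : Op H)) x := by
      refine Filter.EventuallyEq.fderiv_eq ?_
      filter_upwards [hnx] with y hy using (hB y hy).symm
    rw [h3, h2.fderiv, neg_apply, ContinuousLinearMap.smulRight_apply, fderiv_rep,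
      neg_eq_iff_add_eq_zero, add_sub_cancel, ← map_zero (M.score x)] at h1
    exact raise_injective hx (score_injective hx h1)
  obtain ⟨u, hu⟩ := M.isOpen_dom.exists_is_const_of_fderiv_eq_zero
    M.isConnected_dom.isPreconnected hdd hd0
  have hlin : ∀ x, HasFDerivAt (fun y => u ⬝ᵥ y) _ x := hasFDerivAt_dotProduct u
  obtain ⟨c, hc⟩ := M.isOpen_dom.exists_is_const_of_fderiv_eq_zero
    M.isConnected_dom.isPreconnected (f := fun x => M.rep f x - u ⬝ᵥ x)
    (hfd.sub fun x _ => (hlin x).differentiableAt.differentiableWithinAt) (fun x hx => by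
      have h1 := (hfd.differentiableAt (M.isOpen_dom.mem_nhds hx)).hasFDerivAt
      rw [(h1.fun_sub (hlin x)).fderiv]
      ext1 v
      rw [sub_apply, fderiv_rep, hu x hx]
      simp [dotProduct])
  refine ⟨c, u, funext fun p => ?_⟩
  rw [← hc _ (coord_mem p), rep_coord]
  simp [dotProduct]

end IsEfficientFrame

/-- Here i-th gradients are shown e-parallel, so that L_{grad ξ^i} + ξ^i is locally, hence globally
on the connected domain, one operator A. -/
theorem EAutoparallel.exists_isEfficientFrame (hE : M.EAutoparallel) (hM : M.IsMAffine) :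
    ∃ A, M.IsEfficientFrame A := by
  suffices h : ∀ i, ∃ A : Op H, A ∈ hermitian H ∧
      ∀ x ∈ M.dom, A - x i • (1 : Op H) = M.score x (M.raise x (Pi.single i 1)) by
    choose A hA using h
    exact ⟨A, hA⟩
  intro i
  let e : Fin n → ℝ := Pi.single i 1
  have hX : M.IsField fun x => M.raise x e := isField_raise contDiffOn_const
  have hpar : ∀ x ∈ M.dom, ∀ k : Fin n,
      fderiv ℝ (fun y => M.score y (M.raise y e)) x (Pi.single k 1) = -(e k • (1 : Op H)) := by
    intro x hx k
    obtain ⟨W, -, hW⟩ := hE (basisField k) _ contDiffOn_const hX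
    -- Autoparallelism makes the covariant derivative tangent to M, so its pairings with the ∂_j
    -- determine it. By duality each is the derivative of a constant, since ∂_j is m-parallel.
    have hW0 : W x = 0 := by
      rw [← raise_lower hx (W x)]
      suffices h : M.lower x (W x) = 0 by rw [h, raise_zero]
      funext j
      have h1 := (hM k j).2 _ hX x hx _ (hW x hx)
      have h2 : fderiv ℝ (fun y => metric (M.param y) (M.push (fun x => M.raise x e) y)
          (M.push (basisField j) y)) x = 0 := by
        refine ((hasFDerivAt_const (e j) x).congr_of_eventuallyEq ?_).fderiv
        filter_upwards [M.isOpen_dom.mem_nhds hx] with y hy using metric_raise_single hy e j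
      rw [h2] at h1
      simp only [push, basisField] at h1
      rw [metric_lower hx, metric_lower hx, Pi.zero_apply, dotProduct_zero, add_zero,
        dotProduct_single, mul_one, zero_apply] at h1
      exact h1.symm
    obtain ⟨-, h3⟩ := (hW x hx).sld_eq_fderiv_score hx hX
    rw [push, sld_fderiv hx, hW0, map_zero, lower_raise hx] at h3
    simp only [basisField, dotProduct_single, mul_one] at h3
    exact eq_neg_of_add_eq_zero_left h3.symm
  have hd : ∀ x ∈ M.dom, HasFDerivAt (fun y => M.score y (M.raise y e) + y i • (1 : Op H)) _ x :=
    fun x hx => (differentiableAt_score hX hx).hasFDerivAt.add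
      ((hasFDerivAt_apply i x).smul_const (1 : Op H))
  obtain ⟨A, hA⟩ := M.isOpen_dom.exists_is_const_of_fderiv_eq_zero
    M.isConnected_dom.isPreconnected
    (fun x hx => (hd x hx).differentiableAt.differentiableWithinAt) (fun x hx => by
      rw [(hd x hx).fderiv]
      refine ContinuousLinearMap.coe_injective (LinearMap.pi_ext' fun k => LinearMap.ext_ring ?_)
      have := hpar x hx k
      simp only [LinearMap.comp_apply, LinearMap.coe_single, ContinuousLinearMap.coe_coe, add_apply,
        this]
      simp [e, Pi.single_apply, eq_comm])
  -- A is Hermitian because it equals a Hermitian score plus a real scalar at any one point of the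
  -- nonempty domain.
  refine ⟨A, ?_, fun x hx => by rw [← hA x hx, add_sub_cancel_right]⟩
  obtain ⟨x, hx⟩ := M.isConnected_dom.nonempty
  rw [← hA x hx, mem_hermitian_iff, star_add, mem_hermitian_iff.1 (score_mem_hermitian hx _),
    mem_hermitian_iff.1 (hermitian_smul _ one_mem_hermitian)]

end Model

end QuantumModel

end

/-! ### The equivalence of the three conditions -/

theorem mainTheorem3 {H : Type*} [NormedAddCommGroup H] [InnerProductSpace ℂ H]
    [FiniteDimensional ℂ H] {n : ℕ} (M : QuantumModel.Model H n) :
    List.TFAE [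
      M.EAutoparallel ∧ M.IsMAffine,
      ∀ i : Fin n, (fun p => M.coord p i) ∈ M.effFunctions,
      M.effFunctions =
        {f | ∃ (c : ℝ) (u : Fin n → ℝ), f = fun p => c + ∑ i, u i * M.coord p i}] := by
  haveI := FiniteDimensional.complete ℂ H
  tfae_have 1 → 2 := fun ⟨hE, hM⟩ =>
    QuantumModel.Model.coord_mem_effFunctions_iff.2 (hE.exists_isEfficientFrame hM)
  tfae_have 2 → 1 := fun h => by
    obtain ⟨A, hA⟩ := QuantumModel.Model.coord_mem_effFunctions_iff.1 h
    exact ⟨hA.eAutoparallel, hA.isMAffine⟩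
  tfae_have 2 → 3 := fun h => by
    obtain ⟨A, hA⟩ := QuantumModel.Model.coord_mem_effFunctions_iff.1 h
    refine Subset.antisymm (fun f hf => hA.exists_affine hf) ?_
    rintro _ ⟨c, u, rfl⟩
    exact hA.affine_mem_effFunctions c u
  tfae_have 3 → 2 := fun h i => by
    rw [h]
    exact ⟨0, Pi.single i 1, QuantumModel.Model.coord_eq_affine i⟩
  tfae_finish
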